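/- Let $G$ be a finite group and $\mathcal P$ a set of prime numbers. Write $\mathbb Z_{\mathcal P}=\mathbb Z[p^{-1}\mid p\notin\mathcal P]\subseteq\mathbb Q$ ($p$ ranging over primes), let $RU(G)$ be the complex representation ring of $G$ (the Grothendieck ring of finite-dimensional complex representations, with product induced by $\otimes_{\mathbb C}$), and put $RU_{\mathcal P}(G)=RU(G)\otimes_{\mathbb Z}\mathbb Z_{\mathcal P}$. Let $\mathcal O$ be the ring of integers of the $\exp(G)$-th cyclotomic field inside $\mathbb C$, where $\exp(G)$ is the exponent of $G$. For $g\in G$ let $\hat\chi(-)(g)\colon RU_{\mathcal P}(G)\otimes\mathcal O\to\mathbb C$ be the ring homomorphism $\sum_i\lambda_iV_i\mapsto\sum_i\lambda_i\,\chi_{V_i}(g)$ with $\lambda_i \in \mathcal O\otimes\mathbb Z_{\mathcal P}\subseteq\mathbb C$ (its values lie in $\mathcal O\otimes\mathbb Z_{\mathcal P}$), and let $P_{(0),g}=\{V \mid \hat\chi(V)(g)=0\}$, a prime ideal. Every $g\in G$ is uniquely a product $g=g_{\mathcal P}\,g_{\mathcal P'}$ of powers of $g$ such that the order of $g_{\mathcal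 P}$ is divisible only by primes in $\mathcal P$ and the order of $g_{\mathcal P'}$ is divisible by no prime in $\mathcal P$. An element $x\in G$ is called $\mathcal P$-prime if its order is divisible by no prime in $\mathcal P$, equivalently if $x_{\mathcal P'}=x$. An idempotent is primitive if it is non-zero and is not the sum of two non-zero idempotents. 1. The map sending $x\in G$ to the connected component of $P_{(0),x}$ in $\operatorname{Spec}(RU_{\mathcal P}(G)\otimes\mathcal O)$ induces a bijection from the set of conjugacy classes of $\mathcal P$-prime elements of $G$ to the set of connected components of $\operatorname{Spec}(RU_{\mathcal P}(G)\otimes\mathcal O)$. 2. There is a bijection $(x)\mapsto e_x$ from the set of conjugacy classes of $\mathcal P$-prime elements of $G$ to the set of primitive idempotents of $RU_{\mathcal P}(G)\otimes\mathcal O$ such that, for every $\mathcal P$-prime $x\in G$, the set of prime ideals not containing $e_x$ is the connected component of $P_{(0),x}$, and for all $g\in G$ $$\hat\chi(e_x)(g)=\begin{cases}1&\text{if } g_{\mathcal P'} \text{ is conjugate to } x \text{ in } G,\\ 0&\text{otherwise.}\end{cases}$$ 3. In particular, $\operatorname{Spec}(RU(G)\otimes\mathcal O)$ is connected. -/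

import Mathlib

namespace RepRing

universe u

open CategoryTheory MonoidalCategory
open scoped TensorProduct NumberField MonoidAlgebra

noncomputable section

/-! ### Elements of `P`-order and `P`-prime elements -/

section Group

variable {G : Type u} [Group G]

/-- `x` is a `P`-prime element: its order is prime to all primes in `P`. -/
def IsPPrime (P : Set Nat.Primes) (x : G) : Prop :=
  ∀ p ∈ P, ¬ (p : ℕ) ∣ orderOf x

/-- The order of `x` is divisible only by primes in `P`. -/
def IsPElement (P : Set Nat.Primes) (x : G) : Prop :=
  ∀ p : Nat.Primes, (p : ℕ) ∣ orderOf x → p ∈ P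

theorem exists_split (P : Set Nat.Primes) (n : ℕ) (hn : n ≠ 0) :
    ∃ a b : ℕ, a * b = n ∧ (∀ p : Nat.Primes, (p : ℕ) ∣ a → p ∈ P) ∧
      (∀ p ∈ P, ¬ (p : ℕ) ∣ b) := by
  induction n using Nat.recOnMul with
  | zero => exact absurd rfl hn
  | one =>
    exact ⟨1, 1, rfl, fun p hp => absurd (Nat.dvd_one.1 hp) p.2.one_lt.ne',
      fun p _ hp => absurd (Nat.dvd_one.1 hp) p.2.one_lt.ne'⟩
  | prime q hq =>
    by_cases h : (⟨q, hq⟩ : Nat.Primes) ∈ P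
    · refine ⟨q, 1, mul_one q, fun p hp => ?_,
        fun p _ hp => absurd (Nat.dvd_one.1 hp) p.2.one_lt.ne'⟩
      have : p = ⟨q, hq⟩ := Subtype.ext ((Nat.prime_dvd_prime_iff_eq p.2 hq).1 hp)
      rwa [this]
    · refine ⟨1, q, one_mul q, fun p hp => absurd (Nat.dvd_one.1 hp) p.2.one_lt.ne',
        fun p hpP hp => h ?_⟩
      have : p = ⟨q, hq⟩ := Subtype.ext ((Nat.prime_dvd_prime_iff_eq p.2 hq).1 hp)
      rwa [← this]
  | mul m k hm hk =>
    obtain ⟨a, b, hab, ha, hb⟩ := hm (left_ne_zero_of_mul hn)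
    obtain ⟨c, d, hcd, hc, hd⟩ := hk (right_ne_zero_of_mul hn)
    refine ⟨a * c, b * d, by rw [← hab, ← hcd]; ring, fun p hp => ?_, fun p hpP hp => ?_⟩
    · exact (p.2.dvd_mul.1 hp).elim (ha p) (hc p)
    · exact (p.2.dvd_mul.1 hp).elim (hb p hpP) (hd p hpP)

/-- Every `g` can be written in exactly one way as `(g * h⁻¹) * h` where `h` is a power of `g`
of order prime to `P` and the order of `g * h⁻¹` is divisible only by primes in `P`. -/
theorem existsUnique_pPrimePart [Finite G] (P : Set Nat.Primes) (g : G) :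
    ∃! h : G, h ∈ Subgroup.zpowers g ∧ IsPPrime P h ∧ IsPElement P (g * h⁻¹) := by
  obtain ⟨a, b, hab, ha, hb⟩ := exists_split P (orderOf g) (orderOf_pos g).ne'
  have hcop : a.Coprime b := Nat.Coprime.symm <| Nat.coprime_of_dvd fun p hp h1 h2 =>
    hb ⟨p, hp⟩ (ha ⟨p, hp⟩ h2) h1
  obtain ⟨m, hm0, hm1⟩ := Nat.chineseRemainder hcop 0 1
  refine ⟨g ^ m, ⟨⟨m, by simp⟩, ?_, ?_⟩, ?_⟩
  · intro p hp hd
    refine hb p hp (hd.trans (orderOf_dvd_of_pow_eq_one ?_))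
    rw [← pow_mul]
    apply orderOf_dvd_iff_pow_eq_one.1
    rw [← hab]
    exact Nat.mul_dvd_mul_right ((Nat.modEq_zero_iff_dvd).1 hm0) b
  · intro p hd
    refine ha p (hd.trans (orderOf_dvd_of_pow_eq_one ?_))
    have hc : Commute g (g ^ m)⁻¹ := ((Commute.refl g).pow_right m).inv_right
    rw [hc.mul_pow, inv_pow, ← pow_mul, mul_inv_eq_one, pow_eq_pow_iff_modEq, ← hab]
    have := (hm1.mul_left' a).symm
    rwa [mul_one, mul_comm a m] at this
  · rintro h ⟨hz, h1, h2⟩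
    have key : ∀ x y : G, x ∈ Subgroup.zpowers g → y ∈ Subgroup.zpowers g →
        IsPPrime P x → IsPPrime P y → IsPElement P (g * x⁻¹) → IsPElement P (g * y⁻¹) →
        x = y := by
      rintro x y ⟨i, rfl⟩ ⟨j, rfl⟩ hx hy hx' hy'
      have c1 : Commute ((g ^ i)⁻¹) (g ^ j) :=
        (((Commute.refl g).zpow_left i).zpow_right j).inv_left
      have c2 : Commute (g * (g ^ i)⁻¹) (g * (g ^ j)⁻¹)⁻¹ := by
        rw [← zpow_neg, ← zpow_neg, ← zpow_one_add, ← zpow_one_add]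
        exact (((Commute.refl g).zpow_left _).zpow_right _).inv_right
      have e : (g ^ i)⁻¹ * g ^ j = (g * (g ^ i)⁻¹) * (g * (g ^ j)⁻¹)⁻¹ := by
        rw [← zpow_neg, ← zpow_neg, ← zpow_one_add, ← zpow_one_add, ← zpow_neg, ← zpow_add,
          ← zpow_add]
        congr 1
        ring
      by_contra hne
      have hne' : orderOf ((g ^ i)⁻¹ * g ^ j) ≠ 1 := by
        rw [Ne, orderOf_eq_one_iff, inv_mul_eq_one]
        exact hne
      obtain ⟨p, hp, hpd⟩ := Nat.exists_prime_and_dvd hne'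
      have hpd' := hpd
      rw [e] at hpd'
      have hP : (⟨p, hp⟩ : Nat.Primes) ∈ P := by
        have := hpd'.trans c2.orderOf_mul_dvd_mul_orderOf
        rw [orderOf_inv] at this
        exact (hp.dvd_mul.1 this).elim (hx' ⟨p, hp⟩) (hy' ⟨p, hp⟩)
      have := hpd.trans c1.orderOf_mul_dvd_mul_orderOf
      rw [orderOf_inv] at this
      exact (hp.dvd_mul.1 this).elim (hx _ hP) (hy _ hP)
    refine key _ _ hz ⟨m, by simp⟩ h1 ?_ h2 ?_
    · intro p hp hd
      refine hb p hp (hd.trans (orderOf_dvd_of_pow_eq_one ?_))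
      rw [← pow_mul]
      apply orderOf_dvd_iff_pow_eq_one.1
      rw [← hab]
      exact Nat.mul_dvd_mul_right ((Nat.modEq_zero_iff_dvd).1 hm0) b
    · intro p hd
      refine ha p (hd.trans (orderOf_dvd_of_pow_eq_one ?_))
      have hc : Commute g (g ^ m)⁻¹ := ((Commute.refl g).pow_right m).inv_right
      rw [hc.mul_pow, inv_pow, ← pow_mul, mul_inv_eq_one, pow_eq_pow_iff_modEq, ← hab]
      have := (hm1.mul_left' a).symm
      rwa [mul_one, mul_comm a m] at this

/-- The `P`-prime part of `g`. -/
def pPrimePart [Finite G] (P : Set Nat.Primes) (g : G) : G :=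
  (existsUnique_pPrimePart P g).choose

variable (G) in
/-- The conjugacy classes of `P`-prime elements of `G`. -/
def PPrimeClasses (P : Set Nat.Primes) : Set (ConjClasses G) :=
  ConjClasses.mk '' {x | IsPPrime P x}

/-- The conjugacy class of a `P`-prime element. -/
def PPrimeClasses.mk {P : Set Nat.Primes} (x : G) (hx : IsPPrime P x) : PPrimeClasses G P :=
  ⟨ConjClasses.mk x, x, hx, rfl⟩

end Group

/-! ### The representation ring and its scalar extensions -/

section Ring

variable (G : Type u) [Group G]

/-- The relations `[V ⊕ W] = [V] + [W]` in the monoid ring `ℤ[M]`, where `M` is the monoid of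
isomorphism classes of finite-dimensional complex representations of `G` under `⊗`. -/
def directSumRelations : Set ℤ[Skeleton (FDRep ℂ G)] :=
  {r | ∃ V W : FDRep ℂ G,
    r = MonoidAlgebra.of ℤ _ (toSkeleton (FDRep.of (Representation.prod V.ρ W.ρ))) -
      (MonoidAlgebra.of ℤ _ (toSkeleton V) + MonoidAlgebra.of ℤ _ (toSkeleton W))}

/-- The complex representation ring `RU(G)`: the Grothendieck ring of finite-dimensional complex
representations of `G`, that is, the free abelian group on isomorphism classes, with the
multiplication induced by `⊗`, modulo the relations `[V ⊕ W] = [V] + [W]`. (The subgroup generated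
by the relations is already an ideal, as `⊗` distributes over `⊕`.) -/
def RU : Type (max 1 u) :=
  ℤ[Skeleton (FDRep ℂ G)] ⧸ Ideal.span (directSumRelations G)

instance : CommRing (RU G) :=
  inferInstanceAs (CommRing (ℤ[Skeleton (FDRep ℂ G)] ⧸ Ideal.span (directSumRelations G)))

/-- The ring `ℤ[p⁻¹ | p ∉ P]`, as a subring of `ℚ`. -/
def ZP (P : Set Nat.Primes) : Subring ℚ :=
  Subring.closure {q | ∃ p : Nat.Primes, p ∉ P ∧ q = ((p : ℕ) : ℚ)⁻¹}

/-- The cyclotomic field of `exp(G)`-th roots of unity, inside `ℂ`. -/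
abbrev SplitField : IntermediateField ℚ ℂ :=
  IntermediateField.adjoin ℚ {z : ℂ | z ^ Monoid.exponent G = 1}

/-- The `P`-local representation ring `RU(G) ⊗ ℤ[p⁻¹ | p ∉ P]`. -/
def RUP (P : Set Nat.Primes) : Type (max 1 u) := RU G ⊗[ℤ] ZP P

instance (P : Set Nat.Primes) : CommRing (RUP G P) :=
  inferInstanceAs (CommRing (RU G ⊗[ℤ] ZP P))

/-- `RU_P(G) ⊗ 𝒪`, with `𝒪` the ring of integers of the `exp(G)`-th cyclotomic field. -/
def RUPO (P : Set Nat.Primes) : Type (max 1 u) := RUP G P ⊗[ℤ] 𝓞 (SplitField G)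

instance (P : Set Nat.Primes) : CommRing (RUPO G P) :=
  inferInstanceAs (CommRing (RUP G P ⊗[ℤ] 𝓞 (SplitField G)))

end Ring

/-! ### Characters -/

section Character

variable {G : Type u} [Group G]

/-- `[V] ↦ χ(V)(g)` on isomorphism classes of representations. -/
def skeletonChar (g : G) : Skeleton (FDRep ℂ G) →* ℂ where
  toFun := Quotient.lift (fun V : FDRep ℂ G => V.character g)
    fun _ _ ⟨i⟩ => congrFun (FDRep.char_iso i) g
  map_one' := by
    change LinearMap.trace ℂ ℂ (LinearMap.id) = 1
    simp
  map_mul' X Y := by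
    induction X using Quotient.inductionOn with | _ V
    induction Y using Quotient.inductionOn with | _ W
    have h := Skeleton.toSkeleton_tensorObj V W
    change Quotient.lift _ _ (toSkeleton V * toSkeleton W) = _
    rw [← h]
    exact congrFun (FDRep.char_tensor V W) g

theorem skeletonChar_toSkeleton (g : G) (V : FDRep ℂ G) :
    skeletonChar g (toSkeleton V) = V.character g := rfl

theorem character_prod (g : G) (V W : FDRep ℂ G) :
    (FDRep.of (Representation.prod V.ρ W.ρ)).character g = V.character g + W.character g :=
  LinearMap.trace_prodMap' (V.ρ g) (W.ρ g)

/-- The ring homomorphism `RU(G) → ℂ`, `V ↦ χ(V)(g)`. -/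
def charRU (g : G) : RU G →+* ℂ :=
  Ideal.Quotient.lift (Ideal.span (directSumRelations G))
    (MonoidAlgebra.lift ℤ ℂ _ (skeletonChar g)).toRingHom (by
      intro a ha
      have hle : Ideal.span (directSumRelations G) ≤
          RingHom.ker (MonoidAlgebra.lift ℤ ℂ _ (skeletonChar g)).toRingHom := by
        rw [Ideal.span_le]
        rintro r ⟨V, W, rfl⟩
        simp [RingHom.mem_ker, skeletonChar_toSkeleton, character_prod]
      exact hle ha)

/-- The character value at `g`, extended to a ring homomorphism on `RU(G) ⊗ ℤ[p⁻¹ | p ∉ P]`. -/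
def charRUP (P : Set Nat.Primes) (g : G) : RUP G P →+* ℂ :=
  (Algebra.TensorProduct.productMap (charRU g).toIntAlgHom
    ((algebraMap ℚ ℂ).comp (ZP P).subtype).toIntAlgHom).toRingHom

/-- The character value at `g`, extended `𝒪`-linearly to a ring homomorphism on `RU_P(G) ⊗ 𝒪`:
`∑ λᵢ • Vᵢ ↦ ∑ λᵢ * χ(Vᵢ)(g)`. (All its values lie in the subring `𝒪 ⊗ ℤ[p⁻¹ | p ∉ P]` of `ℂ`.) -/
def charHat (P : Set Nat.Primes) (g : G) : RUPO G P →+* ℂ :=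
  (Algebra.TensorProduct.productMap (charRUP P g).toIntAlgHom
    ((algebraMap (SplitField G) ℂ).comp
      (algebraMap (𝓞 (SplitField G)) (SplitField G))).toIntAlgHom).toRingHom

/-- The prime ideal `{V | χ(V)(g) = 0}` of `RU_P(G) ⊗ 𝒪`, the preimage under the character value
at `g` of the zero ideal. -/
def primeZero (P : Set Nat.Primes) (g : G) : PrimeSpectrum (RUPO G P) :=
  ⟨RingHom.ker (charHat P g), RingHom.ker_isPrime _⟩

end Character

/-- `e` is a primitive idempotent: a nonzero idempotent that is not a sum of two nonzero
idempotents. -/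
def IsPrimitiveIdempotent {R : Type*} [CommRing R] (e : R) : Prop :=
  IsIdempotentElem e ∧ e ≠ 0 ∧
    ∀ a b : R, IsIdempotentElem a → IsIdempotentElem b → e = a + b → a = 0 ∨ b = 0

end

end RepRing

/-!
The proof identifies `RUPO G P` with a ring of class functions and works with their values.

*Characters separate.* By Maschke's theorem (`induction_irreducible`) the ring `RU G` is additively
generated by irreducible representations, and by the orthogonality relations these have linearly
independent characters. Clearing denominators prime to `P`, the homomorphisms `charHat P g` are
jointly injective on `RUPO G P` (`charHat_ext`). As `G` is finite, each prime ideal therefore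
contains the kernel `primeZero P g` of one of them, so each connected component contains some
`primeZero P g`.

*Few components.* If `p ∈ P` and `g`, `h` have the same `p ^ n`-th power, then modulo a prime above
`p` the Frobenius map identifies the character values at `g` and `h` (`comp_charInt_eq`), because
these are sums of roots of unity. So `primeZero P g` and `primeZero P h` lie in a common prime ideal
and in the same component. Removing the primary parts of `g` for one prime of `P` after the other,
the component of `primeZero P g` is that of `primeZero P (pPrimePart P g)`.

*Enough idempotents.* It remains to find, for each `P`-prime `x`, an element of `RUPO G P` whose
character is the indicator function of the `P`-section `{g | pPrimePart P g ∼ x}`. A class function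
whose scalar products with all characters lie in `𝒪` comes from `RUPO G P` (`exists_charHat_eq`).
For a prime `p` and an element `y` of order prime to `p`, let `Q` be a Sylow `p`-subgroup of the
centralizer of `y`, and let `f g` be the number of cosets `t Q` with `t⁻¹ g t ∈ y Q`
(`cosetCount`). Its scalar product with a character is the trace of `y⁻¹` on `Q`-invariants, hence
lies in `𝒪`; it vanishes off the `p`-section of `y`, and on the section it is prime to `p` by
counting fixed points of a `p`-group. A power `f ^ N` is congruent to the indicator function of
the section modulo the `p`-part of the order of `G`, and a class function divisible by the whole
order of `G` comes from `RUPO G P`; so does a multiple of the indicator function by an integer prime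
to `p`. Summing over `p`-sections and combining all `p ∈ P` gives the indicator function of the
`P`-section (`exists_charHat_eq_indicator`).

These idempotents separate the components found before, and their open sets are exactly the
components. For `P` the set of all primes `RUPO G P` is `RU(G) ⊗ 𝒪`, and `1` is the only
`P`-prime element.
-/

namespace RepRing

open CategoryTheory MonoidalCategory
open scoped TensorProduct NumberField MonoidAlgebra

universe u v w

noncomputable section

/-! ### Decomposing representations into irreducible ones -/

section Decomposition

variable {k : Type u} {G : Type v} [Field k] [Group G]

/-- A representation is the direct sum of two complementary subrepresentations. -/
def equivProdOfIsCompl {V : Type w} [AddCommGroup V] [Module k V]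
    {ρ : Representation k G V} {σ τ : Subrepresentation ρ}
    (h : IsCompl σ.toSubmodule τ.toSubmodule) :
    (σ.toRepresentation.prod τ.toRepresentation).Equiv ρ :=
  Representation.Equiv.mk (Submodule.prodEquivOfIsCompl _ _ h) fun g => by
    ext x <;> simp [Representation.prod, Subrepresentation.toRepresentation]

/-- Maschke's theorem as an induction principle: an isomorphism-invariant property of
finite-dimensional representations which holds for zero and irreducible representations and is
stable under direct sums holds for all of them. -/
theorem induction_irreducible [Finite G] [NeZero (Nat.card G : k)]
    (motive : ∀ (V : Type w) [AddCommGroup V] [Module k V] [FiniteDimensional k V],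
      Representation k G V → Prop)
    (equiv : ∀ (V W : Type w) [AddCommGroup V] [Module k V] [FiniteDimensional k V]
      [AddCommGroup W] [Module k W] [FiniteDimensional k W]
      (ρ : Representation k G V) (σ : Representation k G W),
      ρ.Equiv σ → motive V ρ → motive W σ)
    (zero : ∀ (V : Type w) [AddCommGroup V] [Module k V] [FiniteDimensional k V]
      (ρ : Representation k G V), Subsingleton V → motive V ρ)
    (irreducible : ∀ (V : Type w) [AddCommGroup V] [Module k V] [FiniteDimensional k V]
      (ρ : Representation k G V), ρ.IsIrreducible → motive V ρ)
    (prod : ∀ (V W : Type w) [AddCommGroup V] [Module k V] [FiniteDimensional k V]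
      [AddCommGroup W] [Module k W] [FiniteDimensional k W]
      (ρ : Representation k G V) (σ : Representation k G W),
      motive V ρ → motive W σ → motive (V × W) (ρ.prod σ))
    (V : Type w) [AddCommGroup V] [Module k V] [FiniteDimensional k V]
    (ρ : Representation k G V) : motive V ρ := by
  induction hn : Module.finrank k V using Nat.strong_induction_on generalizing V with
  | _ n ih =>
  rcases subsingleton_or_nontrivial V with hV | hV
  · exact zero V ρ hV
  by_cases hirr : ρ.IsIrreducible
  · exact irreducible V ρ hirr
  have : Nontrivial (Subrepresentation ρ) := by
    refine ⟨⊥, ⊤, fun h => ?_⟩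
    have h' : (⊥ : Submodule k V) = ⊤ := congrArg Subrepresentation.toSubmodule h
    exact bot_ne_top h'
  obtain ⟨σ, hσ⟩ : ∃ σ : Subrepresentation ρ, σ ≠ ⊥ ∧ σ ≠ ⊤ := by
    by_contra! h
    exact hirr ⟨fun σ => or_iff_not_imp_left.2 (h σ)⟩
  obtain ⟨τ, hστ⟩ := exists_isCompl σ
  have hc : IsCompl σ.toSubmodule τ.toSubmodule := by
    constructor
    · rw [disjoint_iff]
      exact congrArg Subrepresentation.toSubmodule hστ.inf_eq_bot
    · rw [codisjoint_iff]
      exact congrArg Subrepresentation.toSubmodule hστ.sup_eq_top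
  have hadd := Submodule.finrank_add_eq_of_isCompl hc
  have h1 : 0 < Module.finrank k σ.toSubmodule := by
    rw [Module.finrank_pos_iff, Submodule.nontrivial_iff_ne_bot]
    exact fun h => hσ.1 (Subrepresentation.toSubmodule_injective h)
  have h2 : Module.finrank k σ.toSubmodule < Module.finrank k V := by
    refine Submodule.finrank_lt fun h => hσ.2 (Subrepresentation.toSubmodule_injective h)
  exact equiv _ _ _ _ (equivProdOfIsCompl hc) (prod _ _ _ _
    (ih _ (by omega) _ σ.toRepresentation rfl) (ih _ (by omega) _ τ.toRepresentation rfl))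

theorem char_prod {V W : Type*} [AddCommGroup V] [Module k V] [FiniteDimensional k V]
    [AddCommGroup W] [Module k W] [FiniteDimensional k W]
    (ρ : Representation k G V) (σ : Representation k G W) (g : G) :
    (ρ.prod σ).character g = ρ.character g + σ.character g :=
  LinearMap.trace_prodMap' (ρ g) (σ g)

/-- Schur's lemma: an endomorphism commuting with an irreducible representation is a scalar. -/
theorem exists_eq_smul_id [IsAlgClosed k] {V : Type*} [AddCommGroup V] [Module k V]
    [FiniteDimensional k V] {ρ : Representation k G V} (hρ : ρ.IsIrreducible)
    (T : V →ₗ[k] V) (hT : ∀ g, T ∘ₗ ρ g = ρ g ∘ₗ T) : ∃ c : k, T = c • LinearMap.id := by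
  obtain ⟨c, hc⟩ :=
    (Representation.IsIrreducible.algebraMap_intertwiningMap_bijective_of_isAlgClosed
      (ρ := ρ)).2 ⟨T, hT⟩
  refine ⟨c, ?_⟩
  exact (congrArg Representation.IntertwiningMap.toLinearMap hc).symm

/-- The character values on the powers of an element `h` are the power sums of one multiset of
roots of unity, the eigenvalues of `h`. -/
theorem exists_multiset_character_pow [Finite G] [IsAlgClosed k] [NeZero (Nat.card G : k)]
    {V : Type w} [AddCommGroup V] [Module k V] [FiniteDimensional k V]
    (ρ : Representation k G V) (h : G) :
    ∃ s : Multiset k, (∀ z ∈ s, z ^ orderOf h = 1) ∧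
      ∀ n : ℕ, ρ.character (h ^ n) = (s.map (· ^ n)).sum := by
  have hne : NeZero (Nat.card (Subgroup.zpowers h) : k) := ⟨fun h0 => by
    have hd : (Nat.card (Subgroup.zpowers h) : k) ∣ (Nat.card G : k) :=
      Nat.cast_dvd_cast (Subgroup.card_subgroup_dvd_card _)
    rw [h0, zero_dvd_iff] at hd
    exact NeZero.ne _ hd⟩
  let h' : Subgroup.zpowers h := ⟨h, Subgroup.mem_zpowers h⟩
  suffices key : ∃ s : Multiset k, (∀ z ∈ s, z ^ orderOf h = 1) ∧
      ∀ n : ℕ, Representation.character (G := Subgroup.zpowers h)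
        (ρ.comp (Subgroup.zpowers h).subtype) (h' ^ n) = (s.map (· ^ n)).sum from key
  refine induction_irreducible (k := k) (G := Subgroup.zpowers h)
    (fun V _ _ _ σ => ∃ s : Multiset k, (∀ z ∈ s, z ^ orderOf h = 1) ∧
      ∀ n : ℕ, σ.character (h' ^ n) = (s.map (· ^ n)).sum) ?_ ?_ ?_ ?_ V _
  · rintro V W _ _ _ _ _ _ ρ σ e ⟨s, hs, hs'⟩
    exact ⟨s, hs, fun n => by rw [← Representation.char_iso e, hs']⟩
  · intro V _ _ _ ρ hV
    refine ⟨0, by simp, fun n => ?_⟩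
    have : ρ (h' ^ n) = 0 := Subsingleton.elim _ _
    simp [Representation.character, this]
  · intro V _ _ _ ρ hρ
    obtain ⟨c, hc⟩ := exists_eq_smul_id hρ (ρ h') fun g => by
      rw [← Module.End.mul_eq_comp, ← Module.End.mul_eq_comp, ← map_mul, ← map_mul, mul_comm']
    have hV : Module.finrank k V = 1 :=
      Representation.IsIrreducible.finrank_eq_one_of_isMulCommutative ρ
    have hpow : ∀ n : ℕ, ρ.character (h' ^ n) = c ^ n := fun n => by
      rw [Representation.character, map_pow, hc, smul_pow, map_smul, ← Module.End.one_eq_id,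
        one_pow, LinearMap.trace_one, hV]
      simp
    refine ⟨{c}, ?_, fun n => by rw [hpow]; simp⟩
    have h1 : h' ^ orderOf h = 1 := Subtype.ext (pow_orderOf_eq_one h)
    have := hpow (orderOf h)
    rw [h1, Representation.char_one, hV] at this
    simpa using this.symm
  · rintro V W _ _ _ _ _ _ ρ σ ⟨s, hs, hs'⟩ ⟨t, ht, ht'⟩
    refine ⟨s + t, fun z hz => (Multiset.mem_add.1 hz).elim (hs z) (ht z), fun n => ?_⟩
    rw [char_prod, hs', ht', Multiset.map_add, Multiset.sum_add]

end Decomposition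

/-! ### Irreducible characters -/

section Irreducible

variable (G : Type u) [Group G]

/-- The isomorphism classes of irreducible complex representations of `G`. -/
def IrrepClass : Type (max 1 u) :=
  {s : Skeleton (FDRep ℂ G) //
    Representation.IsIrreducible (Quotient.out s : FDRep ℂ G).ρ}

variable {G}

/-- A representation in a given isomorphism class of irreducible representations. -/
def IrrepClass.rep (i : IrrepClass G) : FDRep ℂ G := Quotient.out i.1

theorem IrrepClass.isIrreducible (i : IrrepClass G) : Representation.IsIrreducible i.rep.ρ := i.2

theorem IrrepClass.toSkeleton_rep (i : IrrepClass G) : toSkeleton i.rep = i.1 :=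
  Quotient.out_eq i.1

/-- An equivalence of representations as an isomorphism in the category of representations. -/
def isoOfEquiv {V W : FDRep ℂ G} (e : Representation.Equiv V.ρ W.ρ) : V ≅ W :=
  Action.mkIso (LinearEquiv.toFGModuleCatIso e.toLinearEquiv) fun g => by
    ext x
    exact LinearMap.congr_fun (e.isIntertwining' g) x

theorem nonempty_iso_iff_nonempty_equiv {V W : FDRep ℂ G} :
    Nonempty (V ≅ W) ↔ Nonempty (Representation.Equiv V.ρ W.ρ) := by
  refine ⟨fun ⟨i⟩ => ⟨Representation.Equiv.mk (FDRep.isoToLinearEquiv i) fun g => ?_⟩,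
    fun ⟨e⟩ => ⟨isoOfEquiv e⟩⟩
  ext x
  simp [FDRep.Iso.conj_ρ i g, LinearEquiv.conj_apply]

theorem toSkeleton_eq_of_equiv {V W : FDRep ℂ G} (e : Representation.Equiv V.ρ W.ρ) :
    toSkeleton V = toSkeleton W :=
  Quotient.sound ⟨isoOfEquiv e⟩

theorem isIrreducible_of_equiv {k V W : Type*} [Field k] [AddCommGroup V] [Module k V]
    [AddCommGroup W] [Module k W] {ρ : Representation k G V} {σ : Representation k G W}
    (e : ρ.Equiv σ) (h : ρ.IsIrreducible) : σ.IsIrreducible := by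
  rw [Representation.irreducible_iff_isSimpleModule_asModule] at h ⊢
  exact IsSimpleModule.congr (LinearEquiv.ofBijective
    (Representation.IntertwiningMap.equivLinearMapAsModule ρ σ e.toIntertwiningMap)
    e.toLinearEquiv.bijective).symm

theorem exists_irrepClass (V : FDRep ℂ G) (hV : Representation.IsIrreducible V.ρ) :
    ∃ i : IrrepClass G, i.1 = toSkeleton V := by
  have h : toSkeleton (Quotient.out (toSkeleton V) : FDRep ℂ G) = toSkeleton V :=
    Quotient.out_eq _
  obtain ⟨e⟩ := nonempty_iso_iff_nonempty_equiv.1 (Quotient.exact h)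
  exact ⟨⟨toSkeleton V, isIrreducible_of_equiv
    (Representation.Equiv.symm e) hV⟩, rfl⟩

/-- The scalar product of a class function with the character of a representation. -/
def charInner [Fintype G] (f : G → ℂ) (V : FDRep ℂ G) : ℂ :=
  (Nat.card G : ℂ)⁻¹ * ∑ g : G, f g * V.character g⁻¹

theorem charInner_sum [Fintype G] {ι : Type*} (s : Finset ι) (c : ι → ℂ) (f : ι → G → ℂ)
    (V : FDRep ℂ G) :
    charInner (fun g => ∑ i ∈ s, c i * f i g) V = ∑ i ∈ s, c i * charInner (f i) V := by
  simp only [charInner, Finset.sum_mul, Finset.mul_sum]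
  rw [Finset.sum_comm]
  exact Finset.sum_congr rfl fun i _ => Finset.sum_congr rfl fun g _ => by ring

open Classical in
theorem charInner_irrepClass [Fintype G] (i j : IrrepClass G) :
    charInner i.rep.character j.rep = if i = j then 1 else 0 := by
  have : Invertible (Nat.card G : ℂ) :=
    invertibleOfNonzero (Nat.cast_ne_zero.2 Nat.card_pos.ne')
  have hi := i.isIrreducible
  have hj := j.isIrreducible
  refine (Representation.char_orthonormal i.rep.ρ j.rep.ρ).trans ?_
  refine if_congr ?_ rfl rfl
  rw [← nonempty_iso_iff_nonempty_equiv]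
  constructor
  · intro h
    have h' : toSkeleton j.rep = toSkeleton i.rep := Quotient.sound h
    rw [i.toSkeleton_rep, j.toSkeleton_rep] at h'
    exact Subtype.ext h'.symm
  · rintro rfl
    exact ⟨Iso.refl _⟩

/-- A combination of irreducible characters determines its coefficients. -/
theorem charInner_sum_irrepClass [Fintype G] (c : IrrepClass G →₀ ℂ) (j : IrrepClass G) :
    charInner (fun g => c.sum fun i z => z * i.rep.character g) j.rep = c j := by
  classical
  simp only [Finsupp.sum]
  rw [charInner_sum]
  simp [charInner_irrepClass]
  exact fun h => h.symm

/-- For a class function `f`, the operator `∑ h, f h • ρ h⁻¹` is equivariant, hence a scalar on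
each irreducible representation `ρ`. So `g ↦ tr (ρ g ∘ ∑ h, f h • ρ h⁻¹)` is a combination of
irreducible characters for every representation `ρ`. -/
theorem sum_mul_character_mem_span [Fintype G] (f : G → ℂ) (hf : ∀ g h, f (h * g * h⁻¹) = f g)
    (V : Type) [AddCommGroup V] [Module ℂ V] [FiniteDimensional ℂ V]
    (ρ : Representation ℂ G V) :
    (fun g => ∑ h, f h * ρ.character (g * h⁻¹)) ∈
      Submodule.span ℂ (Set.range fun i : IrrepClass G => i.rep.character) := by
  have : NeZero (Nat.card G : ℂ) := ⟨Nat.cast_ne_zero.2 Nat.card_pos.ne'⟩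
  refine induction_irreducible (k := ℂ) (G := G)
    (fun V _ _ _ ρ => (fun g => ∑ h, f h * ρ.character (g * h⁻¹)) ∈
      Submodule.span ℂ (Set.range fun i : IrrepClass G => i.rep.character)) ?_ ?_ ?_ ?_ V ρ
  · intro V W _ _ _ _ _ _ ρ σ e h
    rwa [Representation.char_iso e] at h
  · intro V _ _ _ ρ hV
    have h0 : ρ.character = 0 := by
      ext g
      have : ρ g = 0 := Subsingleton.elim _ _
      simp [Representation.character, this]
    simp only [h0, Pi.zero_apply, mul_zero, Finset.sum_const_zero]
    exact Submodule.zero_mem _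
  · intro V _ _ _ ρ hρ
    obtain ⟨i, hi⟩ := exists_irrepClass (FDRep.of ρ) hρ
    have hchar : i.rep.character = ρ.character := by
      have : toSkeleton i.rep = toSkeleton (FDRep.of ρ) := i.toSkeleton_rep.trans hi
      obtain ⟨j⟩ := Quotient.exact this
      exact FDRep.char_iso j
    obtain ⟨c, hc⟩ := exists_eq_smul_id hρ (∑ h, f h • ρ h⁻¹) fun g => by
      rw [← Module.End.mul_eq_comp, ← Module.End.mul_eq_comp, Finset.sum_mul, Finset.mul_sum]
      refine Fintype.sum_equiv (MulAut.conj g).symm.toEquiv _ _ fun h => ?_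
      rw [smul_mul_assoc, mul_smul_comm, ← map_mul, ← map_mul]
      simp [mul_assoc, ← hf h g⁻¹]
    have : (fun g => ∑ h, f h * ρ.character (g * h⁻¹)) = c • i.rep.character := by
      ext g
      have h1 : LinearMap.trace ℂ V (ρ g * ∑ h, f h • ρ h⁻¹) = c * ρ.character g := by
        rw [hc, ← Module.End.one_eq_id, mul_smul_comm, mul_one, map_smul]
        rfl
      rw [Pi.smul_apply, hchar, smul_eq_mul, ← h1, Finset.mul_sum, map_sum]
      refine Finset.sum_congr rfl fun h _ => ?_
      rw [mul_smul_comm, map_smul, ← map_mul]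
      rfl
    rw [this]
    exact Submodule.smul_mem _ _ (Submodule.subset_span ⟨i, rfl⟩)
  · intro V W _ _ _ _ _ _ ρ σ hρ hσ
    convert Submodule.add_mem _ hρ hσ using 1
    ext g
    simp [char_prod, mul_add, Finset.sum_add_distrib]

/-- The regular representation, realized on `Fin n → ℂ` with `n` the order of the group so that
the underlying space lives in `Type` whatever the universe of `G`. -/
def regularRep [Finite G] : Representation ℂ G (Fin (Nat.card G) → ℂ) where
  toFun g := LinearMap.funLeft ℂ ℂ fun i => Finite.equivFin G (g⁻¹ * (Finite.equivFin G).symm i)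
  map_one' := by ext; simp
  map_mul' g h := by ext; simp [LinearMap.funLeft, mul_assoc]

open Classical in
theorem character_regularRep [Finite G] (g : G) :
    (regularRep (G := G)).character g = if g = 1 then (Nat.card G : ℂ) else 0 := by
  rw [Representation.character, LinearMap.trace_eq_matrix_trace ℂ (Pi.basisFun ℂ _),
    Matrix.trace]
  have h : ∀ i, (LinearMap.toMatrix (Pi.basisFun ℂ _) (Pi.basisFun ℂ _)
      (regularRep (G := G) g)).diag i = if g = 1 then 1 else 0 := fun i => by
    rw [Matrix.diag_apply, LinearMap.toMatrix_apply]
    simp [regularRep, LinearMap.funLeft, Pi.single_apply, ← Equiv.eq_symm_apply]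
  rw [Finset.sum_congr rfl fun i _ => h i]
  simp

/-- The irreducible characters span the class functions. -/
theorem mem_span_character [Fintype G] (f : G → ℂ) (hf : ∀ g h, f (h * g * h⁻¹) = f g) :
    f ∈ Submodule.span ℂ (Set.range fun i : IrrepClass G => i.rep.character) := by
  classical
  have h := sum_mul_character_mem_span f hf _ (regularRep (G := G))
  have h0 : (Nat.card G : ℂ) ≠ 0 := Nat.cast_ne_zero.2 Nat.card_pos.ne'
  have hf' : f = (Nat.card G : ℂ)⁻¹ •
      fun g => ∑ h, f h * (regularRep (G := G)).character (g * h⁻¹) := by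
    ext g
    simp only [Pi.smul_apply, character_regularRep, mul_inv_eq_one]
    simp [mul_comm _ (Fintype.card G : ℂ)]
  rw [hf']
  exact Submodule.smul_mem _ _ h

/-- Fourier expansion of a class function. -/
theorem exists_eq_sum_charInner [Fintype G] (f : G → ℂ) (hf : ∀ g h, f (h * g * h⁻¹) = f g) :
    ∃ s : Finset (IrrepClass G),
      ∀ g, f g = ∑ i ∈ s, charInner f i.rep * i.rep.character g := by
  obtain ⟨c, hc⟩ := (Finsupp.mem_span_range_iff_exists_finsupp).1 (mem_span_character f hf)
  have hc' : f = fun g => c.sum fun i z => z * i.rep.character g := by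
    rw [← hc]
    ext g
    simp [Finsupp.sum, Finset.sum_apply]
  refine ⟨c.support, fun g => ?_⟩
  have : ∀ i, charInner f i.rep = c i := fun i => by
    conv_lhs => rw [hc']
    exact charInner_sum_irrepClass c i
  simp only [this]
  exact congrFun hc' g

end Irreducible

/-! ### The representation ring and its scalar extensions: generators -/

section Generators

variable {G : Type u} [Group G]

/-- The projection onto `RU G` from the monoid ring of isomorphism classes. -/
def RU.mk : ℤ[Skeleton (FDRep ℂ G)] →+* RU G :=
  Ideal.Quotient.mk (Ideal.span (directSumRelations G))

theorem RU.mk_surjective : Function.Surjective (RU.mk (G := G)) :=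
  Ideal.Quotient.mk_surjective

/-- The class in `RU G` of an isomorphism class of representations. -/
def repClass (s : Skeleton (FDRep ℂ G)) : RU G := RU.mk (MonoidAlgebra.of ℤ _ s)

theorem charRU_repClass (g : G) (V : FDRep ℂ G) :
    charRU g (repClass (toSkeleton V)) = V.character g := by
  refine (Ideal.Quotient.lift_mk _ _ _).trans ?_
  simp [skeletonChar_toSkeleton]

theorem repClass_prod (V W : FDRep ℂ G) :
    repClass (toSkeleton (FDRep.of (Representation.prod V.ρ W.ρ))) =
      repClass (toSkeleton V) + repClass (toSkeleton W) :=
  Ideal.Quotient.eq.2 (Ideal.subset_span ⟨V, W, rfl⟩)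

theorem closure_repClass :
    AddSubgroup.closure (Set.range (repClass (G := G))) = ⊤ := by
  refine (AddSubgroup.eq_top_iff' _).2 fun r => ?_
  obtain ⟨a, rfl⟩ := RU.mk_surjective r
  induction a using MonoidAlgebra.induction_linear with
  | zero => rw [map_zero]; exact AddSubgroup.zero_mem _
  | add a b ha hb => rw [map_add]; exact AddSubgroup.add_mem _ ha hb
  | single s n =>
    have : (MonoidAlgebra.single s n : ℤ[Skeleton (FDRep ℂ G)]) = n • MonoidAlgebra.of ℤ _ s := by
      simp
    rw [this, map_zsmul]
    exact AddSubgroup.zsmul_mem _ (AddSubgroup.subset_closure (Set.mem_range_self s)) n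

/-- The representation ring is additively generated by the irreducible representations. -/
theorem closure_repClass_irrepClass [Finite G] :
    AddSubgroup.closure (Set.range fun i : IrrepClass G => repClass i.1) = ⊤ := by
  have : NeZero (Nat.card G : ℂ) := ⟨Nat.cast_ne_zero.2 Nat.card_pos.ne'⟩
  rw [eq_top_iff, ← closure_repClass, AddSubgroup.closure_le]
  rintro _ ⟨s, rfl⟩
  have hs : s = toSkeleton (FDRep.of (Quotient.out s : FDRep ℂ G).ρ) :=
    (Quotient.out_eq s).symm.trans
      (toSkeleton_eq_of_equiv (Representation.Equiv.mk (LinearEquiv.refl ℂ _) fun _ => rfl))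
  rw [hs]
  refine induction_irreducible (k := ℂ) (G := G) (fun V _ _ _ ρ =>
    repClass (toSkeleton (FDRep.of ρ)) ∈
      AddSubgroup.closure (Set.range fun i : IrrepClass G => repClass i.1)) ?_ ?_ ?_ ?_ _ _
  · intro V W _ _ _ _ _ _ ρ σ e h
    rwa [toSkeleton_eq_of_equiv (V := FDRep.of ρ) (W := FDRep.of σ) e] at h
  · intro V _ _ _ ρ hV
    have e : (ρ.prod ρ).Equiv ρ :=
      Representation.Equiv.mk
        { toFun := fun _ => 0, invFun := fun _ => 0, map_add' := by simp, map_smul' := by simp,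
          left_inv := fun _ => Subsingleton.elim _ _,
          right_inv := fun _ => Subsingleton.elim _ _ } fun g => by ext <;> simp
    -- `V ⊕ V ≅ V` forces `[V] = 0`.
    have h := repClass_prod (FDRep.of ρ) (FDRep.of ρ)
    have h2 : toSkeleton (FDRep.of (Representation.prod (FDRep.of ρ).ρ (FDRep.of ρ).ρ)) =
      toSkeleton (FDRep.of ρ) := toSkeleton_eq_of_equiv e
    rw [h2, left_eq_add] at h
    rw [h]
    exact AddSubgroup.zero_mem _
  · intro V _ _ _ ρ hρ
    obtain ⟨i, hi⟩ := exists_irrepClass (FDRep.of ρ) hρ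
    exact AddSubgroup.subset_closure ⟨i, by simp only [hi]⟩
  · intro V W _ _ _ _ _ _ ρ σ hρ hσ
    exact repClass_prod (FDRep.of ρ) (FDRep.of σ) ▸ AddSubgroup.add_mem _ hρ hσ

variable (G) in
/-- The inclusion of `𝒪` in `ℂ`. -/
def intEmb : 𝓞 (SplitField G) →+* ℂ :=
  (algebraMap (SplitField G) ℂ).comp (algebraMap (𝓞 (SplitField G)) (SplitField G))

theorem intEmb_injective : Function.Injective (intEmb G) :=
  (algebraMap (SplitField G) ℂ).injective.comp
    (FaithfulSMul.algebraMap_injective (𝓞 (SplitField G)) (SplitField G))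

theorem exists_intEmb_eq {z : ℂ} (hz : IsIntegral ℤ z) (hz' : z ∈ SplitField G) :
    ∃ a, intEmb G a = z := by
  have : IsIntegral ℤ (⟨z, hz'⟩ : SplitField G) :=
    (isIntegral_algHom_iff (f := (algebraMap (SplitField G) ℂ).toIntAlgHom)
      (algebraMap (SplitField G) ℂ).injective).1 hz
  exact ⟨⟨⟨z, hz'⟩, this⟩, rfl⟩

theorem isIntegral_intEmb (a : 𝓞 (SplitField G)) : IsIntegral ℤ (intEmb G a) :=
  a.2.map (algebraMap (SplitField G) ℂ).toIntAlgHom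

variable (P : Set Nat.Primes)

/-- The ring homomorphism `RUP G P → RUPO G P`. -/
def fromRUP : RUP G P →+* RUPO G P :=
  (Algebra.TensorProduct.includeLeftRingHom : RUP G P →+* RUP G P ⊗[ℤ] 𝓞 (SplitField G))

/-- The ring homomorphism `RU G → RUPO G P`. -/
def fromRU : RU G →+* RUPO G P :=
  (fromRUP P).comp
    (Algebra.TensorProduct.includeLeftRingHom : RU G →+* RU G ⊗[ℤ] ZP P)

/-- The ring homomorphism `ℤ[p⁻¹ | p ∉ P] → RUPO G P`. -/
def fromZP : ZP P →+* RUPO G P :=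
  (fromRUP P).comp
    (Algebra.TensorProduct.includeRight : ZP P →ₐ[ℤ] RU G ⊗[ℤ] ZP P).toRingHom

/-- The ring homomorphism `𝒪 → RUPO G P`. -/
def fromO : 𝓞 (SplitField G) →+* RUPO G P :=
  (Algebra.TensorProduct.includeRight : 𝓞 (SplitField G) →ₐ[ℤ]
    RUP G P ⊗[ℤ] 𝓞 (SplitField G)).toRingHom

variable {P}

theorem charHat_fromRU (g : G) (r : RU G) : charHat P g (fromRU P r) = charRU g r := by
  refine (Algebra.TensorProduct.productMap_apply_tmul _ _ _ _).trans ?_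
  rw [map_one, mul_one]
  refine (Algebra.TensorProduct.productMap_apply_tmul _ _ _ _).trans ?_
  rw [map_one, mul_one]
  rfl

theorem charHat_fromZP (g : G) (z : ZP P) : charHat P g (fromZP P z) = ((z : ℚ) : ℂ) := by
  refine (Algebra.TensorProduct.productMap_apply_tmul _ _ _ _).trans ?_
  rw [map_one, mul_one]
  refine (Algebra.TensorProduct.productMap_apply_tmul _ _ _ _).trans ?_
  rw [map_one, one_mul]
  rfl

theorem charHat_fromO (g : G) (a : 𝓞 (SplitField G)) :
    charHat P g (fromO P a) = intEmb G a := by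
  refine (Algebra.TensorProduct.productMap_apply_tmul _ _ _ _).trans ?_
  rw [map_one, one_mul]
  rfl

theorem tensorProduct_induction {A B : Type*} [CommRing A] [CommRing B]
    {motive : A ⊗[ℤ] B → Prop} (zero : motive 0)
    (add : ∀ v w, motive v → motive w → motive (v + w))
    (mul : ∀ a b, motive ((Algebra.TensorProduct.includeLeftRingHom : A →+* A ⊗[ℤ] B) a *
      (Algebra.TensorProduct.includeRight : B →ₐ[ℤ] A ⊗[ℤ] B) b)) (v : A ⊗[ℤ] B) : motive v := by
  induction v with
  | zero => exact zero
  | tmul a b => simpa using mul a b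
  | add v w hv hw => exact add v w hv hw

/-- `RUPO G P` is additively generated by the products of elements of the three factors. -/
theorem RUPO.induction {motive : RUPO G P → Prop} (zero : motive 0)
    (add : ∀ v w, motive v → motive w → motive (v + w))
    (mul : ∀ (r : RU G) (z : ZP P) (a : 𝓞 (SplitField G)),
      motive (fromRU P r * fromZP P z * fromO P a)) (v : RUPO G P) : motive v := by
  refine tensorProduct_induction (A := RUP G P) (B := 𝓞 (SplitField G))
    (motive := motive) zero add (fun w a => ?_) v
  change motive (fromRUP P w * fromO P a)
  refine tensorProduct_induction (A := RU G) (B := ZP P)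
    (motive := fun w => motive (fromRUP P w * fromO P a)) ?_ (fun x y hx hy => ?_)
    (fun r z => ?_) w
  · exact ((congrArg (· * fromO P a) (map_zero (fromRUP P))).trans (zero_mul _)).symm ▸ zero
  · have h : fromRUP P (x + y) * fromO P a = fromRUP P x * fromO P a + fromRUP P y * fromO P a :=
      (congrArg (· * fromO P a) (map_add (fromRUP P) x y)).trans (add_mul _ _ _)
    exact h ▸ add _ _ hx hy
  · exact (congrArg (· * fromO P a) (map_mul (fromRUP P) _ _)).symm ▸ mul r z a

/-! ### The ring `ℤ[p⁻¹ | p ∉ P]` -/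

theorem isUnit_natCast_ZP {n : ℕ} (hn : n ≠ 0) (h : ∀ p ∈ P, ¬ (p : ℕ) ∣ n) :
    IsUnit (n : ZP P) := by
  induction n using Nat.recOnMul with
  | zero => exact absurd rfl hn
  | one => simp
  | prime q hq =>
    have hqP : (⟨q, hq⟩ : Nat.Primes) ∉ P := fun hq' => h _ hq' dvd_rfl
    refine IsUnit.of_mul_eq_one ⟨(q : ℚ)⁻¹, Subring.subset_closure ⟨⟨q, hq⟩, hqP, rfl⟩⟩ ?_
    ext
    simp [hq.ne_zero]
  | mul a b ha hb =>
    rw [Nat.cast_mul]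
    exact (ha (left_ne_zero_of_mul hn) fun p hp hd => h p hp (hd.mul_right b)).mul
      (hb (right_ne_zero_of_mul hn) fun p hp hd => h p hp (hd.mul_left a))

/-- The elements of `ℤ[p⁻¹ | p ∉ P]` are fractions whose denominators are prime to `P`. -/
theorem exists_natCast_mul_eq_intCast (z : ZP P) :
    ∃ n : ℕ, n ≠ 0 ∧ (∀ p ∈ P, ¬ (p : ℕ) ∣ n) ∧ ∃ m : ℤ, (n : ZP P) * z = m := by
  obtain ⟨z, hz⟩ := z
  suffices h : ∃ n : ℕ, n ≠ 0 ∧ (∀ p ∈ P, ¬ (p : ℕ) ∣ n) ∧ ∃ m : ℤ, (n : ℚ) * z = m by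
    obtain ⟨n, h0, h1, m, h2⟩ := h
    exact ⟨n, h0, h1, m, Subtype.ext (by simpa using h2)⟩
  have h1 : ∀ p ∈ P, ¬ (p : ℕ) ∣ 1 := fun p _ hp => p.2.one_lt.ne' (Nat.dvd_one.1 hp)
  have hmul : ∀ a b : ℕ, (∀ p ∈ P, ¬ (p : ℕ) ∣ a) → (∀ p ∈ P, ¬ (p : ℕ) ∣ b) →
      ∀ p ∈ P, ¬ (p : ℕ) ∣ a * b := fun a b ha hb p hp hd =>
    (p.2.dvd_mul.1 hd).elim (ha p hp) (hb p hp)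
  induction hz using Subring.closure_induction with
  | mem x hx =>
    obtain ⟨q, hq, rfl⟩ := hx
    refine ⟨q, q.2.ne_zero, fun p hp hd => hq ?_, 1, by simp [q.2.ne_zero]⟩
    rwa [← Subtype.ext ((Nat.prime_dvd_prime_iff_eq p.2 q.2).1 hd)]
  | zero => exact ⟨1, one_ne_zero, h1, 0, by simp⟩
  | one => exact ⟨1, one_ne_zero, h1, 1, by simp⟩
  | add x y _ _ hx hy =>
    obtain ⟨a, a0, ha, m, hm⟩ := hx
    obtain ⟨b, b0, hb, n, hn⟩ := hy
    refine ⟨a * b, mul_ne_zero a0 b0, hmul a b ha hb, b * m + a * n, ?_⟩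
    push_cast
    rw [← hm, ← hn]
    ring
  | neg x _ hx =>
    obtain ⟨a, a0, ha, m, hm⟩ := hx
    exact ⟨a, a0, ha, -m, by simp [hm]⟩
  | mul x y _ _ hx hy =>
    obtain ⟨a, a0, ha, m, hm⟩ := hx
    obtain ⟨b, b0, hb, n, hn⟩ := hy
    refine ⟨a * b, mul_ne_zero a0 b0, hmul a b ha hb, m * n, ?_⟩
    push_cast
    rw [← hm, ← hn]
    ring

theorem not_isUnit_prime_ZP {p : Nat.Primes} (hp : p ∈ P) : ¬ IsUnit ((p : ℕ) : ZP P) := by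
  intro h
  obtain ⟨z, hz⟩ := h.exists_right_inv
  obtain ⟨n, _, hn, m, hm⟩ := exists_natCast_mul_eq_intCast z
  have h1 : (n : ZP P) = ((p : ℕ) : ZP P) * m := by
    rw [← hm, mul_left_comm, hz, mul_one]
  have h2 : (n : ℚ) = ((p : ℕ) : ℚ) * m := by simpa using congrArg (fun x : ZP P => (x : ℚ)) h1
  have h3 : (n : ℤ) = ((p : ℕ) : ℤ) * m := by exact_mod_cast h2
  exact hn p hp (Int.natCast_dvd_natCast.1 ⟨m, h3⟩)

/-! ### Characters separate the elements of `RUPO G P` -/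

theorem exists_natCast_mul_eq_sum [Finite G] (v : RUPO G P) :
    ∃ n : ℕ, IsUnit (n : RUPO G P) ∧ ∃ c : IrrepClass G →₀ 𝓞 (SplitField G),
      n * v = c.sum fun i a => fromRU P (repClass i.1) * fromO P a := by
  classical
  let S : AddSubgroup (RUPO G P) := AddMonoidHom.range
    (Finsupp.liftAddHom fun i : IrrepClass G =>
      (AddMonoidHom.mulLeft (fromRU P (repClass i.1))).comp (fromO P).toAddMonoidHom)
  suffices h : ∃ n : ℕ, IsUnit (n : RUPO G P) ∧ n * v ∈ S by
    obtain ⟨n, hn, c, hc⟩ := h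
    exact ⟨n, hn, c, hc.symm⟩
  induction v using RUPO.induction with
  | zero => exact ⟨1, by simp, by simp⟩
  | add v w hv hw =>
    obtain ⟨a, ha, hav⟩ := hv
    obtain ⟨b, hb, hbw⟩ := hw
    refine ⟨a * b, by simpa using ha.mul hb, ?_⟩
    have : ((a * b : ℕ) : RUPO G P) * (v + w) = b • (a * v) + a • (b * w) := by
      simp only [nsmul_eq_mul]
      push_cast
      ring
    rw [this]
    exact S.add_mem (S.nsmul_mem hav b) (S.nsmul_mem hbw a)
  | mul r z a =>
    obtain ⟨n, h0, hn, m, hm⟩ := exists_natCast_mul_eq_intCast z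
    refine ⟨n, by simpa using (isUnit_natCast_ZP h0 hn).map (fromZP (G := G) P), ?_⟩
    have h1 : (n : RUPO G P) * fromZP (G := G) P z = m := by
      rw [← map_natCast (fromZP (G := G) P), ← map_mul, hm, map_intCast]
    have h2 : (n : RUPO G P) * (fromRU P r * fromZP P z * fromO P a) =
        m • (fromRU P r * fromO P a) := by
      rw [zsmul_eq_mul, ← h1]
      ring
    rw [h2]
    refine S.zsmul_mem ?_ m
    clear h2
    have hr : r ∈ AddSubgroup.closure (Set.range fun i : IrrepClass G => repClass i.1) := by
      rw [closure_repClass_irrepClass]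
      exact AddSubgroup.mem_top r
    induction hr using AddSubgroup.closure_induction with
    | mem x hx =>
      obtain ⟨i, rfl⟩ := hx
      exact ⟨Finsupp.single i a, by simp⟩
    | zero => rw [map_zero, zero_mul]; exact S.zero_mem
    | add x y _ _ hx hy =>
      rw [map_add, add_mul]
      exact S.add_mem hx hy
    | neg x _ hx =>
      rw [map_neg, neg_mul]
      exact S.neg_mem hx

/-- An element of `RUPO G P` is determined by its character values: up to a unit it is an
`𝒪`-combination of irreducible representations, and irreducible characters are linearly
independent. -/
theorem charHat_ext [Finite G] {v w : RUPO G P} (h : ∀ g, charHat P g v = charHat P g w) :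
    v = w := by
  have := Fintype.ofFinite G
  rw [← sub_eq_zero]
  replace h : ∀ g, charHat P g (v - w) = 0 := fun g => by rw [map_sub, h, sub_self]
  generalize v - w = v at h
  obtain ⟨n, hn, c, hc⟩ := exists_natCast_mul_eq_sum v
  suffices h0 : c = 0 by
    rwa [h0, Finsupp.sum_zero_index, hn.mul_right_eq_zero] at hc
  ext1 j
  apply intEmb_injective
  have h1 := charInner_sum_irrepClass (c.mapRange (intEmb G) (map_zero _)) j
  have h2 : ∀ g, ((c.mapRange (intEmb G) (map_zero _)).sum fun i z => z * i.rep.character g) =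
      0 := fun g => by
    have h3 := congrArg (charHat P g) hc
    rw [map_mul, h, mul_zero, Finsupp.sum, map_sum] at h3
    rw [Finsupp.sum_mapRange_index (by simp), Finsupp.sum, h3]
    refine Finset.sum_congr rfl fun i _ => ?_
    rw [map_mul, charHat_fromO, charHat_fromRU, ← i.toSkeleton_rep, charRU_repClass, mul_comm]
  simp only [h2] at h1
  simpa [charInner] using h1.symm

end Generators

/-! ### The `P`-prime part of an element -/

section PPrimePart

variable {G : Type u} [Group G] {P P' : Set Nat.Primes} {x y g : G}

theorem IsPPrime.of_dvd {H : Type*} [Group H] {h : H} (hx : IsPPrime P x)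
    (hd : orderOf h ∣ orderOf x) : IsPPrime P h :=
  fun p hp hp' => hx p hp (hp'.trans hd)

theorem IsPElement.of_dvd {H : Type*} [Group H] {h : H} (hx : IsPElement P x)
    (hd : orderOf h ∣ orderOf x) : IsPElement P h :=
  fun p hp => hx p (hp.trans hd)

theorem IsPPrime.mul (hx : IsPPrime P x) (hy : IsPPrime P y) (h : Commute x y) :
    IsPPrime P (x * y) := fun p hp hd =>
  (p.2.dvd_mul.1 (hd.trans h.orderOf_mul_dvd_mul_orderOf)).elim (hx p hp) (hy p hp)

theorem IsPElement.mul (hx : IsPElement P x) (hy : IsPElement P y) (h : Commute x y) :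
    IsPElement P (x * y) := fun p hd =>
  (p.2.dvd_mul.1 (hd.trans h.orderOf_mul_dvd_mul_orderOf)).elim (hx p) (hy p)

theorem IsPPrime.inv (hx : IsPPrime P x) : IsPPrime P x⁻¹ := hx.of_dvd (by rw [orderOf_inv])

theorem IsPElement.inv (hx : IsPElement P x) : IsPElement P x⁻¹ := hx.of_dvd (by rw [orderOf_inv])

theorem orderOf_conj (g h : G) : orderOf (h * g * h⁻¹) = orderOf g :=
  (MulAut.conj h).orderOf_eq g

theorem IsPPrime.eq_one (h : IsPPrime P x) (h' : IsPElement P x) : x = 1 := by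
  by_contra hne
  obtain ⟨p, hp, hd⟩ := Nat.exists_prime_and_dvd (mt orderOf_eq_one_iff.1 hne)
  exact h ⟨p, hp⟩ (h' ⟨p, hp⟩ hd) hd

theorem IsPElement.one : IsPElement P (1 : G) := fun p hp => by
  rw [orderOf_one] at hp
  exact absurd (Nat.dvd_one.1 hp) p.2.one_lt.ne'

theorem commute_of_mem_zpowers {g h x : G} (hx : x ∈ Subgroup.zpowers g) (h' : Commute g h) :
    Commute x h := by
  obtain ⟨n, rfl⟩ := hx
  exact h'.zpow_left n

variable [Finite G]

theorem pPrimePart_mem_zpowers (P : Set Nat.Primes) (g : G) :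
    pPrimePart P g ∈ Subgroup.zpowers g :=
  (existsUnique_pPrimePart P g).choose_spec.1.1

theorem isPPrime_pPrimePart (P : Set Nat.Primes) (g : G) : IsPPrime P (pPrimePart P g) :=
  (existsUnique_pPrimePart P g).choose_spec.1.2.1

theorem isPElement_mul_inv_pPrimePart (P : Set Nat.Primes) (g : G) :
    IsPElement P (g * (pPrimePart P g)⁻¹) :=
  (existsUnique_pPrimePart P g).choose_spec.1.2.2

theorem commute_pPrimePart (P : Set Nat.Primes) (g : G) : Commute (pPrimePart P g) g :=
  commute_of_mem_zpowers (pPrimePart_mem_zpowers P g) (Commute.refl g)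

theorem pPrimePart_mul (hx : IsPPrime P x) (hy : IsPElement P y) (h : Commute x y) :
    pPrimePart P (x * y) = x := by
  set g := x * y with hg
  have hxg : Commute x g := (Commute.refl x).mul_right h
  have hx' : Commute (pPrimePart P g) x :=
    commute_of_mem_zpowers (pPrimePart_mem_zpowers P g) hxg.symm
  have h1 : IsPPrime P (x⁻¹ * pPrimePart P g) :=
    hx.inv.mul (isPPrime_pPrimePart P g) hx'.symm.inv_left
  have h2 : x⁻¹ * pPrimePart P g = y * (g * (pPrimePart P g)⁻¹)⁻¹ := by
    rw [mul_inv_rev, inv_inv, hg, mul_inv_rev, ← hg, ← mul_assoc, ← mul_assoc]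
    have hy' : Commute y (pPrimePart P g) :=
      (commute_of_mem_zpowers (pPrimePart_mem_zpowers P g) (h.mul_left (Commute.refl y))).symm
    rw [hy'.eq, mul_inv_cancel_right, hx'.inv_right.eq]
  have h3 : IsPElement P (x⁻¹ * pPrimePart P g) := by
    rw [h2]
    refine hy.mul (isPElement_mul_inv_pPrimePart P g).inv ?_
    refine Commute.inv_right (Commute.mul_right (h.symm.mul_right (Commute.refl y)) ?_)
    exact ((commute_of_mem_zpowers (pPrimePart_mem_zpowers P g)
      (h.mul_left (Commute.refl y))).symm).inv_right
  exact (inv_mul_eq_one.1 (h1.eq_one h3)).symm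

theorem IsPPrime.pPrimePart_eq (hx : IsPPrime P x) : pPrimePart P x = x := by
  simpa using pPrimePart_mul hx IsPElement.one (Commute.one_right x)

theorem pPrimePart_conj (P : Set Nat.Primes) (g h : G) :
    pPrimePart P (h * g * h⁻¹) = h * pPrimePart P g * h⁻¹ := by
  have h1 : h * g * h⁻¹ =
      (h * pPrimePart P g * h⁻¹) * (h * (g * (pPrimePart P g)⁻¹) * h⁻¹) := by
    have := (commute_pPrimePart P g).eq
    simp only [mul_assoc, inv_mul_cancel_left]
    rw [← mul_assoc (pPrimePart P g) g, this]
    simp only [mul_assoc, mul_inv_cancel_left]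
  rw [h1]
  refine pPrimePart_mul ((isPPrime_pPrimePart P g).of_dvd (orderOf_conj _ _).dvd)
    ((isPElement_mul_inv_pPrimePart P g).of_dvd (orderOf_conj _ _).dvd) ?_
  exact ((commute_pPrimePart P g).mul_right (Commute.refl _).inv_right).map (MulAut.conj h)

theorem isConj_pPrimePart (P : Set Nat.Primes) {g h : G} (hgh : IsConj g h) :
    IsConj (pPrimePart P g) (pPrimePart P h) := by
  obtain ⟨c, rfl⟩ := isConj_iff.1 hgh
  exact isConj_iff.2 ⟨c, (pPrimePart_conj P g c).symm⟩

theorem pPrimePart_pPrimePart (h : P' ⊆ P) (g : G) :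
    pPrimePart P (pPrimePart P' g) = pPrimePart P g := by
  set a := pPrimePart P' g
  set b := pPrimePart P a
  have hab : Commute b a := commute_pPrimePart P a
  have hag : Commute a g := commute_pPrimePart P' g
  have hbg : Commute b g := commute_of_mem_zpowers (pPrimePart_mem_zpowers P a) hag
  have h1 : g = b * ((a * b⁻¹) * (g * a⁻¹)) := by
    rw [← mul_assoc, hab.inv_left.symm.eq, mul_inv_cancel_left, ← mul_assoc, hag.eq,
      mul_inv_cancel_right]
  have h2 : Commute (a * b⁻¹) (g * a⁻¹) :=
    (hag.mul_right (Commute.refl a).inv_right).mul_left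
      (hbg.mul_right hab.inv_right).inv_left
  have h3 : IsPElement P ((a * b⁻¹) * (g * a⁻¹)) :=
    (isPElement_mul_inv_pPrimePart P a).mul
      (fun p hp => h (isPElement_mul_inv_pPrimePart P' g p hp)) h2
  conv_rhs => rw [h1]
  refine (pPrimePart_mul (isPPrime_pPrimePart P a) h3 ?_).symm
  exact (hab.mul_right (Commute.refl b).inv_right).mul_right (hbg.mul_right hab.inv_right)

theorem IsPElement.exists_pow_eq_one {p : Nat.Primes} (h : IsPElement {p} x) :
    ∃ k : ℕ, x ^ (p : ℕ) ^ k = 1 := by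
  refine ⟨_, orderOf_dvd_iff_pow_eq_one.1 (dvd_of_eq
    (Nat.eq_prime_pow_of_unique_prime_dvd (orderOf_pos x).ne' fun {q} hq hd => ?_))⟩
  exact congrArg Subtype.val (h ⟨q, hq⟩ hd)

theorem exists_pow_eq_pPrimePart_pow (p : Nat.Primes) (g : G) :
    ∃ k : ℕ, g ^ (p : ℕ) ^ k = pPrimePart {p} g ^ (p : ℕ) ^ k := by
  obtain ⟨k, hk⟩ := (isPElement_mul_inv_pPrimePart {p} g).exists_pow_eq_one
  refine ⟨k, ?_⟩
  rwa [(commute_pPrimePart {p} g).symm.inv_right.mul_pow, inv_pow, mul_inv_eq_one] at hk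

/-- The `P`-prime part is reached by passing to `p`-prime parts for single primes `p ∈ P`. -/
theorem pPrimePart_induction {motive : G → Prop} (P : Set Nat.Primes) (g : G)
    (prime : motive (pPrimePart P g))
    (step : ∀ p ∈ P, ∀ h : G, motive (pPrimePart {p} h) → motive h) : motive g := by
  induction hn : orderOf g using Nat.strong_induction_on generalizing g with
  | _ n ih =>
  by_cases hg : IsPPrime P g
  · rwa [hg.pPrimePart_eq] at prime
  · simp only [IsPPrime, not_forall, not_not] at hg
    obtain ⟨p, hp, hd⟩ := hg
    refine step p hp g (ih _ ?_ _ ?_ rfl)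
    · have hdvd : orderOf (pPrimePart {p} g) ∣ orderOf g := by
        obtain ⟨m, hm⟩ := pPrimePart_mem_zpowers {p} g
        rw [← hm]
        exact orderOf_dvd_of_pow_eq_one (by
          change (g ^ m) ^ orderOf g = 1
          rw [← zpow_natCast, zpow_comm, zpow_natCast, pow_orderOf_eq_one, one_zpow])
      rw [← hn]
      refine lt_of_le_of_ne (Nat.le_of_dvd (orderOf_pos g) hdvd) fun h => ?_
      exact isPPrime_pPrimePart {p} g p rfl (h ▸ hd)
    · rwa [pPrimePart_pPrimePart (Set.singleton_subset_iff.2 hp)]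

end PPrimePart

/-! ### Prime ideals of `RUPO G P` -/

section Primes

variable {G : Type u} [Group G] {P : Set Nat.Primes}

theorem RU.induction {motive : RU G → Prop} (zero : motive 0)
    (add : ∀ r s, motive r → motive s → motive (r + s)) (neg : ∀ r, motive r → motive (-r))
    (rep : ∀ V : FDRep ℂ G, motive (repClass (toSkeleton V))) (r : RU G) : motive r := by
  have hr : r ∈ AddSubgroup.closure (Set.range (repClass (G := G))) := by
    rw [closure_repClass]
    exact AddSubgroup.mem_top r
  induction hr using AddSubgroup.closure_induction with
  | mem x hx =>
    obtain ⟨s, rfl⟩ := hx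
    induction s using Quotient.inductionOn with | _ V
    exact rep V
  | zero => exact zero
  | add x y _ _ hx hy => exact add x y hx hy
  | neg x _ hx => exact neg x hx

theorem RUPO.ringHom_ext {R : Type*} [CommRing R] {φ ψ : RUPO G P →+* R}
    (rep : ∀ V : FDRep ℂ G,
      φ (fromRU P (repClass (toSkeleton V))) = ψ (fromRU P (repClass (toSkeleton V))))
    (zp : ∀ z, φ (fromZP P z) = ψ (fromZP P z)) (o : ∀ a, φ (fromO P a) = ψ (fromO P a)) :
    φ = ψ := by
  ext v
  induction v using RUPO.induction with
  | zero => rw [map_zero, map_zero]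
  | add v w hv hw => rw [map_add, map_add, hv, hw]
  | mul r z a =>
    rw [map_mul, map_mul, map_mul, map_mul, zp, o]
    congr 2
    induction r using RU.induction with
    | rep V => exact rep V
    | zero => simp only [map_zero]
    | add x y hx hy => simp only [map_add, hx, hy]
    | neg x hx => simp only [map_neg, hx]

theorem charHat_eq_of_isConj {g h : G} (hgh : IsConj g h) : charHat P g = charHat P h := by
  obtain ⟨c, rfl⟩ := isConj_iff.1 hgh
  refine RUPO.ringHom_ext (fun V => ?_) (fun z => ?_) fun a => ?_
  · rw [charHat_fromRU, charHat_fromRU, charRU_repClass, charRU_repClass, FDRep.char_conj]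
  · rw [charHat_fromZP, charHat_fromZP]
  · rw [charHat_fromO, charHat_fromO]

theorem primeZero_eq_of_isConj {g h : G} (hgh : IsConj g h) : primeZero P g = primeZero P h :=
  PrimeSpectrum.ext (congrArg RingHom.ker (charHat_eq_of_isConj hgh))

theorem connectedComponent_eq_of_le {R : Type*} [CommRing R] {x y : PrimeSpectrum R}
    (h : x ≤ y) : connectedComponent x = connectedComponent y := by
  refine connectedComponent_eq ?_
  exact closure_minimal (Set.singleton_subset_iff.2 mem_connectedComponent)
    isClosed_connectedComponent ((PrimeSpectrum.le_iff_mem_closure x y).1 h)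

variable [Finite G]

theorem exists_multiset_character (V : FDRep ℂ G) (h : G) :
    ∃ s : Multiset ℂ, (∀ z ∈ s, z ^ orderOf h = 1) ∧
      ∀ n : ℕ, V.character (h ^ n) = (s.map (· ^ n)).sum :=
  have : NeZero (Nat.card G : ℂ) := ⟨Nat.cast_ne_zero.2 Nat.card_pos.ne'⟩
  exists_multiset_character_pow (k := ℂ) V.ρ h

theorem isIntegral_of_pow_eq_one {z : ℂ} {n : ℕ} (hn : 0 < n) (h : z ^ n = 1) : IsIntegral ℤ z :=
  IsIntegral.of_pow hn (h ▸ isIntegral_one)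

theorem isIntegral_charRU (g : G) (r : RU G) : IsIntegral ℤ (charRU g r) := by
  induction r using RU.induction with
  | rep V =>
    rw [charRU_repClass]
    obtain ⟨s, hs, hs'⟩ := exists_multiset_character V g
    have := hs' 1
    simp only [pow_one, Multiset.map_id'] at this
    rw [this]
    exact IsIntegral.multiset_sum fun z hz => isIntegral_of_pow_eq_one (orderOf_pos g) (hs z hz)
  | zero => rw [map_zero]; exact isIntegral_zero
  | add x y hx hy => rw [map_add]; exact hx.add hy
  | neg x hx => rw [map_neg]; exact hx.neg

theorem isIntegral_charHat (g : G) (v : RUPO G P) : IsIntegral (ZP P) (charHat P g v) := by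
  induction v using RUPO.induction with
  | zero => rw [map_zero]; exact isIntegral_zero
  | add v w hv hw => rw [map_add]; exact hv.add hw
  | mul r z a =>
    rw [map_mul, map_mul, charHat_fromRU, charHat_fromZP, charHat_fromO]
    exact ((isIntegral_charRU g r).tower_top.mul (isIntegral_algebraMap (x := z))).mul
      (isIntegral_intEmb a).tower_top

/-- The character value at `g` as a ring homomorphism to the integral closure of
`ℤ[p⁻¹ | p ∉ P]` in `ℂ`. -/
def charInt (P : Set Nat.Primes) (g : G) :
    RUPO G P →+* integralClosure (ZP P) ℂ :=
  (charHat P g).codRestrict (integralClosure (ZP P) ℂ) (isIntegral_charHat g)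

/-- The primes in `P` are not invertible in the integral closure of `ℤ[p⁻¹ | p ∉ P]`. -/
theorem exists_isPrime_charP {p : Nat.Primes} (hp : p ∈ P) :
    ∃ Q : Ideal (integralClosure (ZP P) ℂ), Q.IsPrime ∧
      CharP (integralClosure (ZP P) ℂ ⧸ Q) p := by
  have hinj : Function.Injective (algebraMap (ZP P) (integralClosure (ZP P) ℂ)) := fun a b hab => by
    have : algebraMap (ZP P) ℂ a = algebraMap (ZP P) ℂ b :=
      congrArg (algebraMap (integralClosure (ZP P) ℂ) ℂ) hab
    exact Subtype.ext ((algebraMap ℚ ℂ).injective this)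
  obtain ⟨m, hm, hpm⟩ := exists_max_ideal_of_mem_nonunits (not_isUnit_prime_ZP hp)
  obtain ⟨Q, hQ, hQm⟩ := Ideal.exists_ideal_over_prime_of_isIntegral_of_isDomain
    (S := integralClosure (ZP P) ℂ) m
    (by rw [(RingHom.injective_iff_ker_eq_bot _).1 hinj]; exact bot_le)
  refine ⟨Q, hQ, (CharP.charP_iff_prime_eq_zero p.2).2 ?_⟩
  rw [← hQm, Ideal.mem_comap, map_natCast] at hpm
  rw [← map_natCast (Ideal.Quotient.mk Q)]
  exact Ideal.Quotient.eq_zero_iff_mem.2 hpm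

/-- In characteristic `p`, raising a sum of eigenvalues of `g` to the power `p ^ k` amounts to
passing from `g` to `g ^ p ^ k`. -/
theorem pow_map_eq_of_coe_eq_character {k : Type*} [CommRing k] {p : ℕ} [ExpChar k p]
    (ψ : integralClosure (ZP P) ℂ →+* k) (V : FDRep ℂ G) (g : G) (n : ℕ)
    {a b : integralClosure (ZP P) ℂ} (ha : (a : ℂ) = V.character g)
    (hb : (b : ℂ) = V.character (g ^ p ^ n)) : ψ a ^ p ^ n = ψ b := by
  obtain ⟨s, hs, hs'⟩ := exists_multiset_character V g
  obtain ⟨t, rfl⟩ : ∃ t : Multiset (integralClosure (ZP P) ℂ),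
      t.map (integralClosure (ZP P) ℂ).val = s :=
    ⟨s.attach.map fun z => ⟨z.1, (isIntegral_of_pow_eq_one (orderOf_pos g)
      (hs z.1 z.2)).tower_top⟩, by rw [Multiset.map_map]; exact Multiset.attach_map_val s⟩
  have ha' : a = t.sum := by
    refine Subtype.val_injective
      (?_ : (integralClosure (ZP P) ℂ).val _ = (integralClosure (ZP P) ℂ).val _)
    rw [map_multiset_sum, ← (Multiset.map_congr rfl fun z _ => pow_one z :
      (t.map (integralClosure (ZP P) ℂ).val).map (· ^ 1) = _).trans (Multiset.map_id' _), ← hs',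
      pow_one]
    exact ha
  have hb' : b = (t.map (· ^ p ^ n)).sum := by
    refine Subtype.val_injective
      (?_ : (integralClosure (ZP P) ℂ).val _ = (integralClosure (ZP P) ℂ).val _)
    rw [map_multiset_sum, Multiset.map_map]
    refine hb.trans ((hs' _).trans ?_)
    rw [Multiset.map_map]
    simp only [Function.comp_def, map_pow]
  rw [ha', hb', map_multiset_sum, map_multiset_sum, multiset_sum_pow_char_pow, Multiset.map_map,
    Multiset.map_map]
  simp only [Function.comp_def, map_pow]

/-- Modulo a prime above `p`, the character values at `g` and at `h` are identified by a power of
the Frobenius map as soon as `g` and `h` have the same `p ^ n`-th power. -/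
theorem comp_charInt_eq {k : Type*} [CommRing k] [IsDomain k] {p : ℕ} [ExpChar k p]
    (ψ : integralClosure (ZP P) ℂ →+* k) {n : ℕ} {g h : G} (hgh : g ^ p ^ n = h ^ p ^ n) :
    ψ.comp (charInt P g) = ψ.comp (charInt P h) := by
  refine RUPO.ringHom_ext (fun V => ?_) (fun z => ?_) fun a => ?_
  · apply iterateFrobenius_inj k p n
    have hV : ∀ x : G, (charInt P x (fromRU P (repClass (toSkeleton V))) : ℂ) = V.character x :=
      fun x => (charHat_fromRU x _).trans (charRU_repClass x V)
    rw [iterateFrobenius_def, iterateFrobenius_def]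
    exact (pow_map_eq_of_coe_eq_character ψ V g n (hV g) (hV _)).trans
      (pow_map_eq_of_coe_eq_character ψ V h n (hV h) (by rw [← hgh]; exact hV _)).symm
  · exact congrArg ψ (Subtype.ext ((charHat_fromZP g z).trans (charHat_fromZP h z).symm))
  · exact congrArg ψ (Subtype.ext ((charHat_fromO g a).trans (charHat_fromO h a).symm))

theorem exists_primeZero_le {p : Nat.Primes} (hp : p ∈ P) {k : ℕ} {g h : G}
    (hgh : g ^ (p : ℕ) ^ k = h ^ (p : ℕ) ^ k) :
    ∃ q : PrimeSpectrum (RUPO G P), primeZero P g ≤ q ∧ primeZero P h ≤ q := by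
  obtain ⟨Q, hQ, hchar⟩ := exists_isPrime_charP hp
  have := Fact.mk p.2
  have heq := comp_charInt_eq (P := P) (k := integralClosure (ZP P) ℂ ⧸ Q) (p := (p : ℕ))
    (Ideal.Quotient.mk Q) hgh
  have hle : ∀ x : G, RingHom.ker (charHat P x) ≤
      RingHom.ker ((Ideal.Quotient.mk Q).comp (charInt P x)) := fun x v hv => by
    have : charInt P x v = 0 := Subtype.ext hv
    rw [RingHom.mem_ker, RingHom.comp_apply, this, map_zero]
  exact ⟨⟨RingHom.ker ((Ideal.Quotient.mk Q).comp (charInt P g)), RingHom.ker_isPrime _⟩,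
    hle g, heq ▸ hle h⟩

theorem connectedComponent_primeZero_pPrimePart (g : G) :
    connectedComponent (primeZero P g) = connectedComponent (primeZero P (pPrimePart P g)) := by
  refine pPrimePart_induction (motive := fun x => connectedComponent (primeZero P x) =
    connectedComponent (primeZero P (pPrimePart P g))) P g rfl fun p hp h hh => ?_
  obtain ⟨k, hk⟩ := exists_pow_eq_pPrimePart_pow p h
  obtain ⟨q, h1, h2⟩ := exists_primeZero_le hp hk
  rw [← hh, connectedComponent_eq_of_le h1, connectedComponent_eq_of_le h2]

/-- The kernels of the finitely many character homomorphisms have zero intersection, so each prime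
ideal contains one of them. -/
theorem exists_primeZero_le_prime (q : PrimeSpectrum (RUPO G P)) : ∃ g, primeZero P g ≤ q := by
  have := Fintype.ofFinite G
  obtain ⟨g, -, hg⟩ := (q.2.inf_le' (s := Finset.univ)
    (f := fun g : G => RingHom.ker (charHat P g))).1 fun v hv => by
      rw [Submodule.mem_finsetInf] at hv
      rw [charHat_ext (v := v) (w := 0) fun g => by
        rw [map_zero]; exact hv g (Finset.mem_univ g)]
      exact q.asIdeal.zero_mem
  exact ⟨g, hg⟩

theorem exists_connectedComponent_eq (q : PrimeSpectrum (RUPO G P)) :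
    ∃ x, IsPPrime P x ∧ connectedComponent q = connectedComponent (primeZero P x) := by
  obtain ⟨g, hg⟩ := exists_primeZero_le_prime q
  exact ⟨_, isPPrime_pPrimePart P g, by
    rw [← connectedComponent_eq_of_le hg, connectedComponent_primeZero_pPrimePart]⟩

end Primes

/-! ### A virtual character concentrated on one `p`-section -/

section Section

variable {G : Type u} [Group G]

theorem mem_splitField_of_pow_eq_one {z : ℂ} (h : z ^ Monoid.exponent G = 1) :
    z ∈ SplitField G :=
  IntermediateField.subset_adjoin ℚ _ h

variable [Finite G]

/-- The nonzero eigenvalues of `T` are roots of unity, so the trace of `T` lies in `𝒪`. -/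
theorem exists_intEmb_eq_trace {V : Type*} [AddCommGroup V] [Module ℂ V] [FiniteDimensional ℂ V]
    (T : V →ₗ[ℂ] V) (hT : T ^ (Monoid.exponent G + 1) = T) :
    ∃ a, intEmb G a = LinearMap.trace ℂ V T := by
  have he : 0 < Monoid.exponent G := Monoid.ExponentExists.of_finite.exponent_pos
  have hroot : ∀ z ∈ T.charpoly.roots, z = 0 ∨ z ^ Monoid.exponent G = 1 := by
    intro z hz
    have hz' : Module.End.HasEigenvalue T z :=
      (Module.End.hasEigenvalue_iff_isRoot_charpoly T z).2 (Polynomial.isRoot_of_mem_roots hz)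
    obtain ⟨v, hv⟩ := hz'.exists_hasEigenvector
    have h1 := hv.pow_apply (Monoid.exponent G + 1)
    rw [hT, hv.apply_eq_smul] at h1
    have h2 := smul_left_injective ℂ hv.2 h1
    rw [pow_succ] at h2
    by_cases h0 : z = 0
    · exact Or.inl h0
    · exact Or.inr (mul_right_cancel₀ h0 (h2.symm.trans (one_mul z).symm))
  rw [Module.End.trace_eq_sum_roots_charpoly_of_splits (IsAlgClosed.splits _)]
  refine exists_intEmb_eq (IsIntegral.multiset_sum fun z hz => ?_)
    (multiset_sum_mem _ fun z hz => ?_)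
  · rcases hroot z hz with rfl | h
    · exact isIntegral_zero
    · exact isIntegral_of_pow_eq_one he h
  · rcases hroot z hz with rfl | h
    · exact zero_mem _
    · exact mem_splitField_of_pow_eq_one h

theorem exists_intEmb_eq_character (V : FDRep ℂ G) (g : G) :
    ∃ a, intEmb G a = V.character g :=
  exists_intEmb_eq_trace (V.ρ g) (by
    rw [← map_pow, pow_succ, Monoid.pow_exponent_eq_one, one_mul])

/-- For `y` centralizing the subgroup `Q`, the average of a character over `y Q` is the trace of
`y` on the `Q`-invariants, hence lies in `𝒪`. -/
theorem exists_intEmb_eq_average [Fintype G] (V : FDRep ℂ G) (Q : Subgroup G) [Fintype Q] (y : G)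
    (hy : ∀ q ∈ Q, Commute y q) :
    ∃ a, intEmb G a = (Nat.card Q : ℂ)⁻¹ * ∑ q : Q, V.character (y * q)⁻¹ := by
  set π : V →ₗ[ℂ] V := (Nat.card Q : ℂ)⁻¹ • ∑ q : Q, V.ρ (q : G)⁻¹ with hπ
  have hQ : (Nat.card Q : ℂ) ≠ 0 := Nat.cast_ne_zero.2 Nat.card_pos.ne'
  have hqπ : ∀ q : Q, V.ρ (q : G)⁻¹ * π = π := fun q => by
    rw [hπ, mul_smul_comm, Finset.mul_sum]
    congr 1
    refine Fintype.sum_equiv (Equiv.mulRight q) _ _ fun r => ?_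
    rw [← map_mul]
    simp
  have hπ2 : π * π = π := by
    conv_lhs => lhs; rw [hπ]
    rw [smul_mul_assoc, Finset.sum_mul, Finset.sum_congr rfl fun q _ => hqπ q]
    simp [← Nat.cast_smul_eq_nsmul ℂ, smul_smul, ← Nat.card_eq_fintype_card, inv_mul_cancel₀ hQ]
  have hcomm : Commute (V.ρ y⁻¹) π := by
    refine Commute.smul_right (Commute.sum_right _ _ _ fun q _ => ?_) _
    have := (hy q q.2).inv_inv
    rw [Commute, SemiconjBy, ← map_mul, ← map_mul, this.eq]
  obtain ⟨a, ha⟩ := exists_intEmb_eq_trace (G := G) (V.ρ y⁻¹ * π) (by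
    have h1 : ∀ n : ℕ, π ^ (n + 1) = π := fun n => by
      induction n with
      | zero => rw [zero_add, pow_one]
      | succ n ih => rw [pow_succ, ih, hπ2]
    rw [hcomm.mul_pow, h1, pow_succ, ← map_pow, inv_pow, Monoid.pow_exponent_eq_one, inv_one,
      map_one, one_mul])
  refine ⟨a, ha.trans ?_⟩
  rw [hπ, mul_smul_comm, map_smul, smul_eq_mul, Finset.mul_sum, map_sum]
  congr 1
  refine Finset.sum_congr rfl fun q _ => ?_
  rw [← map_mul, ← mul_inv_rev, (hy q q.2).eq]
  rfl

/-- The elements conjugating `g` into the coset `y Q`. -/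
def conjInto (y : G) (Q : Subgroup G) (g : G) : Set G := {t | y⁻¹ * (t⁻¹ * g * t) ∈ Q}

/-- The number of cosets `t Q` with `t⁻¹ g t ∈ y Q`. -/
def cosetCount (y : G) (Q : Subgroup G) (g : G) : ℕ :=
  Nat.card (((↑) : G → G ⧸ Q) '' conjInto y Q g)

omit [Finite G] in
/-- If `y` centralizes `Q`, then `cosetCount y Q` is the class function induced from the
normalized indicator function of `y Q`. -/
theorem card_mul_cosetCount {y : G} {Q : Subgroup G} (hy : ∀ q ∈ Q, Commute y q) (g : G) :
    Nat.card Q * cosetCount y Q g = Nat.card (conjInto y Q g) := by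
  have h : ((↑) : G → G ⧸ Q) ⁻¹' (((↑) : G → G ⧸ Q) '' conjInto y Q g) = conjInto y Q g := by
    refine Set.Subset.antisymm ?_ (Set.subset_preimage_image _ _)
    rintro t ⟨s, hs, hst⟩
    obtain ⟨q, hq, rfl⟩ : ∃ q ∈ Q, t = s * q :=
      ⟨s⁻¹ * t, QuotientGroup.eq.1 hst, (mul_inv_cancel_left s t).symm⟩
    have : y⁻¹ * ((s * q)⁻¹ * g * (s * q)) = q⁻¹ * (y⁻¹ * (s⁻¹ * g * s)) * q := by
      have := ((hy q hq).inv_inv).eq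
      simp only [mul_inv_rev, ← mul_assoc, this]
    change y⁻¹ * ((s * q)⁻¹ * g * (s * q)) ∈ Q
    rw [this]
    exact Q.mul_mem (Q.mul_mem (Q.inv_mem hq) hs) hq
  rw [cosetCount, ← Nat.card_prod, ← Nat.card_congr (QuotientGroup.preimageMkEquivSubgroupProdSet Q
    (((↑) : G → G ⧸ Q) '' conjInto y Q g)), h]

theorem cosetCount_conj {y : G} {Q : Subgroup G} (hy : ∀ q ∈ Q, Commute y q) (g h : G) :
    cosetCount y Q (h * g * h⁻¹) = cosetCount y Q g := by
  have h1 : Nat.card (conjInto y Q (h * g * h⁻¹)) = Nat.card (conjInto y Q g) := by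
    refine Nat.card_congr ((Equiv.mulLeft h⁻¹).subtypeEquiv fun t => ?_)
    have : (h⁻¹ * t)⁻¹ * g * (h⁻¹ * t) = t⁻¹ * (h * g * h⁻¹) * t := by
      simp only [mul_inv_rev, inv_inv, mul_assoc]
    simp only [conjInto, Set.mem_ofPred_eq, Equiv.coe_mulLeft, this]
  rw [← card_mul_cosetCount hy, ← card_mul_cosetCount hy] at h1
  exact Nat.eq_of_mul_eq_mul_left Nat.card_pos h1

/-- Frobenius reciprocity for the class function `cosetCount y Q`. -/
theorem charInner_cosetCount [Fintype G] {y : G} {Q : Subgroup G} [Fintype Q]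
    (hy : ∀ q ∈ Q, Commute y q) (V : FDRep ℂ G) :
    charInner (fun g => cosetCount y Q g) V =
      (Nat.card Q : ℂ)⁻¹ * ∑ q : Q, V.character (y * q)⁻¹ := by
  classical
  have hQ : (Nat.card Q : ℂ) ≠ 0 := Nat.cast_ne_zero.2 Nat.card_pos.ne'
  have hG : (Nat.card G : ℂ) ≠ 0 := Nat.cast_ne_zero.2 Nat.card_pos.ne'
  have h1 : ∀ g, (Nat.card Q : ℂ) * cosetCount y Q g =
      ∑ t : G, if y⁻¹ * (t⁻¹ * g * t) ∈ Q then 1 else 0 := fun g => by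
    rw [← Nat.cast_mul, card_mul_cosetCount hy, Finset.sum_boole, Nat.card_eq_fintype_card,
      Fintype.card_subtype]
    rfl
  have h2 : ∀ t : G, ∑ g, (if y⁻¹ * (t⁻¹ * g * t) ∈ Q then 1 else 0) * V.character g⁻¹ =
      ∑ q : Q, V.character (y * q)⁻¹ := fun t => by
    have h3 : ∑ q : Q, V.character (y * q)⁻¹ =
        ∑ x : G, (if x ∈ Q then 1 else 0) * V.character (y * x)⁻¹ := by
      simp only [ite_mul, one_mul, zero_mul]
      rw [← Finset.sum_filter, Finset.sum_subtype _ (p := (· ∈ Q)) (by simp)]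
    rw [h3]
    refine Fintype.sum_equiv ((MulAut.conj t⁻¹).toEquiv.trans (Equiv.mulLeft y⁻¹)) _ _ fun g => ?_
    have h4 : V.character (t⁻¹ * (g⁻¹ * t)) = V.character g⁻¹ := by
      simpa [mul_assoc] using V.char_conj g⁻¹ t⁻¹
    simp [h4, mul_assoc]
  have h5 : (Nat.card Q : ℂ) * ∑ g, (cosetCount y Q g : ℂ) * V.character g⁻¹ =
      Nat.card G * ∑ q : Q, V.character (y * q)⁻¹ := by
    simp only [Finset.mul_sum (f := fun g => (cosetCount y Q g : ℂ) * V.character g⁻¹),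
      ← mul_assoc (Nat.card Q : ℂ), h1, Finset.sum_mul]
    rw [Finset.sum_comm, Finset.sum_congr rfl fun t _ => h2 t]
    simp
  rw [charInner]
  field_simp
  linear_combination h5

/-- An element of the form `y u`, with `u` a `p`-element of the centralizer `Z` of `y`, is
conjugated into `y Q` exactly by the elements of `Z` whose cosets modulo the Sylow `p`-subgroup
`Q` of `Z` are fixed points of `u`. Their number is congruent to the index of `Q` modulo `p`. -/
theorem not_dvd_cosetCount (p : Nat.Primes) {y u : G} (hy : IsPPrime {p} y)
    (hu : IsPElement {p} u) {Z : Subgroup G} (hZ : ∀ z, z ∈ Z ↔ Commute y z) (huZ : u ∈ Z)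
    (Q : Sylow p Z) (hQ : ∀ q ∈ (Q : Subgroup Z).map Z.subtype, IsPElement {p} q) :
    ¬ (p : ℕ) ∣ cosetCount y ((Q : Subgroup Z).map Z.subtype) (y * u) := by
  have := Fact.mk p.2
  have hyQ : ∀ q ∈ (Q : Subgroup Z).map Z.subtype, Commute y q := by
    rintro _ ⟨q, -, rfl⟩
    exact (hZ _).1 q.2
  let u' : Z := ⟨u, huZ⟩
  let F := MulAction.fixedPoints (Subgroup.zpowers u') (Z ⧸ (Q : Subgroup Z))
  have hF : ∀ t : Z, (t : Z ⧸ (Q : Subgroup Z)) ∈ F ↔ t⁻¹ * u' * t ∈ Q := by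
    intro t
    have h1 : (t : Z ⧸ (Q : Subgroup Z)) ∈ F ↔
        u' ∈ MulAction.stabilizer Z (t : Z ⧸ (Q : Subgroup Z)) := by
      rw [← Subgroup.zpowers_le]
      exact ⟨fun h x hx => h ⟨x, hx⟩, fun h x => h x.2⟩
    rw [h1, MulAction.mem_stabilizer_iff, eq_comm]
    refine QuotientGroup.eq.trans ?_
    rw [mul_assoc]
    rfl
  have hS : conjInto y ((Q : Subgroup Z).map Z.subtype) (y * u) =
      Subtype.val '' (((↑) : Z → Z ⧸ (Q : Subgroup Z)) ⁻¹' F) := by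
    ext t
    constructor
    · intro ht
      -- Compare the `p`-prime parts of the two sides of `t⁻¹ (y u) t = y q`.
      have h1 := pPrimePart_mul hy (hQ _ ht) (hyQ _ ht)
      have h2 := pPrimePart_conj {p} (y * u) t⁻¹
      rw [pPrimePart_mul hy hu ((hZ u).1 huZ)] at h2
      rw [inv_inv] at h2
      rw [mul_inv_cancel_left, h2] at h1
      have htZ : t ∈ Z := (hZ t).2 (by
        rw [mul_assoc, inv_mul_eq_iff_eq_mul] at h1
        exact h1)
      refine ⟨⟨t, htZ⟩, (hF _).2 ?_, rfl⟩
      obtain ⟨q, hq, hq'⟩ := ht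
      suffices h : (⟨t, htZ⟩ : Z)⁻¹ * u' * ⟨t, htZ⟩ = q from h ▸ hq
      refine Subtype.ext (Eq.trans ?_ hq'.symm)
      have hyt : y⁻¹ * t⁻¹ = t⁻¹ * y⁻¹ := ((hZ t).1 htZ).inv_inv.eq
      change t⁻¹ * u * t = _
      simp only [← mul_assoc, hyt]
      simp only [mul_assoc, inv_mul_cancel_left]
    · rintro ⟨t, ht, rfl⟩
      refine ⟨_, (hF t).1 ht, ?_⟩
      have hyt : y⁻¹ * (t : G)⁻¹ = (t : G)⁻¹ * y⁻¹ := ((hZ t).1 t.2).inv_inv.eq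
      change (t : G)⁻¹ * u * t = _
      simp only [← mul_assoc, hyt]
      simp only [mul_assoc, inv_mul_cancel_left]
  have hcard : Nat.card ((Q : Subgroup Z).map Z.subtype) *
      cosetCount y ((Q : Subgroup Z).map Z.subtype) (y * u) =
      Nat.card (Q : Subgroup Z) * Nat.card F := by
    rw [card_mul_cosetCount hyQ, hS, Nat.card_image_of_injective Subtype.val_injective,
      Nat.card_congr (QuotientGroup.preimageMkEquivSubgroupProdSet _ _), Nat.card_prod]
  rw [Nat.card_congr ((Q : Subgroup Z).equivMapOfInjective _ Z.subtype_injective).symm.toEquiv]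
    at hcard
  rw [Nat.eq_of_mul_eq_mul_left Nat.card_pos hcard]
  have hpgroup : IsPGroup p (Subgroup.zpowers u') := by
    obtain ⟨k, hk⟩ := hu.exists_pow_eq_one
    refine IsPGroup.of_card_dvd_pow (n := k) ?_
    rw [Nat.card_zpowers, ← Subgroup.orderOf_coe]
    exact orderOf_dvd_of_pow_eq_one hk
  have hmod := hpgroup.card_modEq_card_fixedPoints (Z ⧸ (Q : Subgroup Z))
  intro hd
  exact Q.not_dvd_index ((hmod.dvd_iff dvd_rfl).2 hd)

theorem cosetCount_eq_zero (p : Nat.Primes) {y g : G} (hy : IsPPrime {p} y) {Q : Subgroup G}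
    (hyQ : ∀ q ∈ Q, Commute y q) (hQ : ∀ q ∈ Q, IsPElement {p} q)
    (hg : ¬ IsConj (pPrimePart {p} g) y) : cosetCount y Q g = 0 := by
  have : conjInto y Q g = ∅ := by
    refine Set.eq_empty_of_forall_notMem fun t ht => hg ?_
    have h1 := pPrimePart_mul hy (hQ _ ht) (hyQ _ ht)
    rw [mul_inv_cancel_left] at h1
    rw [← h1]
    refine isConj_pPrimePart _ (isConj_iff.2 ⟨t⁻¹, by rw [inv_inv]⟩)
  rw [cosetCount, this, Set.image_empty]
  simp

end Section

/-! ### Idempotents supported on `P`-sections -/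

section Idempotents

variable {G : Type u} [Group G] (P : Set Nat.Primes)

/-- A class function whose scalar products with the characters lie in `𝒪` comes from an
element of `RUPO G P`. -/
theorem exists_charHat_eq [Fintype G] (f : G → ℂ) (hf : ∀ g h, f (h * g * h⁻¹) = f g)
    (hint : ∀ V : FDRep ℂ G, ∃ a, intEmb G a = charInner f V) :
    ∃ v : RUPO G P, ∀ g, charHat P g v = f g := by
  obtain ⟨s, hs⟩ := exists_eq_sum_charInner f hf
  choose a ha using hint
  refine ⟨∑ i ∈ s, fromO P (a i.rep) * fromRU P (repClass i.1), fun g => ?_⟩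
  rw [hs, map_sum]
  refine Finset.sum_congr rfl fun i _ => ?_
  rw [map_mul, charHat_fromO, charHat_fromRU, ha, ← i.toSkeleton_rep, charRU_repClass]

variable [Finite G]

/-- An integral class function divisible by the order of `G` comes from `RUPO G P`. -/
theorem exists_charHat_eq_card_mul (k : G → ℤ) (hk : ∀ g h, k (h * g * h⁻¹) = k g) :
    ∃ v : RUPO G P, ∀ g, charHat P g v = Nat.card G * k g := by
  have := Fintype.ofFinite G
  refine exists_charHat_eq P _ (fun g h => by rw [hk]) fun V => ?_
  choose a ha using exists_intEmb_eq_character V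
  refine ⟨∑ g, k g • a g⁻¹, ?_⟩
  have hG : (Nat.card G : ℂ) ≠ 0 := Nat.cast_ne_zero.2 Nat.card_pos.ne'
  rw [charInner, map_sum]
  simp only [mul_assoc, ← Finset.mul_sum]
  rw [inv_mul_cancel_left₀ hG]
  exact Finset.sum_congr rfl fun g _ => by rw [map_zsmul, ha, zsmul_eq_mul]

theorem exists_commute_conj (p : Nat.Primes) {y g : G} (h : IsConj (pPrimePart {p} g) y) :
    ∃ c u : G, Commute y u ∧ IsPElement {p} u ∧ c * g * c⁻¹ = y * u := by
  obtain ⟨c, hc⟩ := isConj_iff.1 h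
  have h1 := pPrimePart_conj {p} g c
  rw [hc] at h1
  have h2 := commute_pPrimePart {p} (c * g * c⁻¹)
  have h3 := isPElement_mul_inv_pPrimePart {p} (c * g * c⁻¹)
  rw [h1] at h2 h3
  refine ⟨c, c * g * c⁻¹ * y⁻¹, h2.mul_right (Commute.refl y).inv_right, h3, ?_⟩
  rw [← h2.inv_left.eq, mul_inv_cancel_left]

/-- The class function `cosetCount y Q`, for `Q` a Sylow `p`-subgroup of the centralizer of `y`,
comes from `RUPO G P`. -/
theorem exists_charHat_eq_natCast (p : Nat.Primes) {y : G} (hy : IsPPrime {p} y) :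
    ∃ f : G → ℕ, (∀ g h, f (h * g * h⁻¹) = f g) ∧
      (∀ g, ¬ IsConj (pPrimePart {p} g) y → f g = 0) ∧
      (∀ g, IsConj (pPrimePart {p} g) y → ¬ (p : ℕ) ∣ f g) ∧
      ∃ v : RUPO G P, ∀ g, charHat P g v = f g := by
  classical
  have := Fintype.ofFinite G
  have := Fact.mk p.2
  have hZ : ∀ z, z ∈ Subgroup.centralizer {y} ↔ Commute y z := fun z =>
    Subgroup.mem_centralizer_singleton_iff.trans eq_comm
  generalize Subgroup.centralizer {y} = Z at hZ
  obtain ⟨Q⟩ : Nonempty (Sylow p Z) := inferInstance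
  set Q' := (Q : Subgroup Z).map Z.subtype with hQ'
  have hyQ : ∀ q ∈ Q', Commute y q := by
    rintro _ ⟨q, -, rfl⟩
    exact (hZ _).1 q.2
  have hQ : ∀ q ∈ Q', IsPElement {p} q := by
    rintro _ ⟨q, hq, rfl⟩ r hr
    obtain ⟨k, hk⟩ := Q.2 ⟨q, hq⟩
    have hk' : (q : G) ^ (p : ℕ) ^ k = 1 := by simpa [Subtype.ext_iff] using hk
    have := r.2.dvd_of_dvd_pow (hr.trans (orderOf_dvd_of_pow_eq_one hk'))
    exact Subtype.ext ((Nat.prime_dvd_prime_iff_eq r.2 p.2).1 this)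
  refine ⟨cosetCount y Q', cosetCount_conj hyQ, fun g hg => cosetCount_eq_zero p hy hyQ hQ hg,
    fun g hg => ?_, exists_charHat_eq P _ (fun g h => by rw [cosetCount_conj hyQ]) fun V => ?_⟩
  · obtain ⟨c, u, hu, hup, hc⟩ := exists_commute_conj p hg
    rw [← cosetCount_conj hyQ g c, hc]
    exact not_dvd_cosetCount p hy hup hZ ((hZ u).2 hu) Q hQ
  · rw [charInner_cosetCount hyQ]
    exact exists_intEmb_eq_average V Q' y hyQ

open Classical in
/-- Euler's theorem: a high power of a class function prime to `p` on a `p`-section and zero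
elsewhere is congruent to the indicator function of the section modulo the `p`-part of the order
of `G`. -/
theorem exists_charHat_eq_indicator_pSection (p : Nat.Primes) {y : G} (hy : IsPPrime {p} y) :
    ∃ v : RUPO G P, ∀ g, charHat P g v =
      if IsConj (pPrimePart {p} g) y then ((ordCompl[p] (Nat.card G) : ℕ) : ℂ) else 0 := by
  obtain ⟨f, hf, hf0, hf1, v, hv⟩ := exists_charHat_eq_natCast P p hy
  set N := Nat.totient (ordProj[p] (Nat.card G))
  have hN : N ≠ 0 := (Nat.totient_pos.2 (Nat.ordProj_pos _ _)).ne'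
  have hdvd : ∀ g, ∃ k : ℤ, (f g : ℤ) ^ N - (if IsConj (pPrimePart {p} g) y then 1 else 0) =
      (ordProj[p] (Nat.card G) : ℕ) * k := by
    intro g
    split_ifs with h
    · have hcop : Nat.Coprime (f g) (ordProj[p] (Nat.card G)) :=
        (Nat.Coprime.pow_left _ ((Nat.Prime.coprime_iff_not_dvd p.2).2 (hf1 g h))).symm
      have := (Nat.ModEq.pow_totient hcop).symm
      rw [Nat.modEq_iff_dvd] at this
      rw [← Nat.cast_pow, ← Nat.cast_one]
      exact this
    · exact ⟨0, by simp [hf0 g h, hN]⟩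
  have hp0 : ((ordProj[p] (Nat.card G) : ℕ) : ℤ) ≠ 0 :=
    Nat.cast_ne_zero.2 (Nat.ordProj_pos _ _).ne'
  choose k hk using hdvd
  have hconj : ∀ g h, IsConj (pPrimePart {p} (h * g * h⁻¹)) y ↔ IsConj (pPrimePart {p} g) y :=
    fun g h => ⟨(isConj_pPrimePart {p} (isConj_iff.2 ⟨h, rfl⟩)).trans,
      (isConj_pPrimePart {p} (isConj_iff.2 ⟨h, rfl⟩)).symm.trans⟩
  obtain ⟨w, hw⟩ := exists_charHat_eq_card_mul P k fun g h => mul_left_cancel₀ hp0 (by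
    rw [← hk, ← hk, hf]
    simp only [hconj])
  refine ⟨(ordCompl[p] (Nat.card G) : ℕ) * v ^ N - w, fun g => ?_⟩
  rw [map_sub, map_mul, map_pow, map_natCast, hv, hw]
  have h1 : ((ordProj[p] (Nat.card G) : ℕ) : ℂ) * (ordCompl[p] (Nat.card G) : ℕ) =
    (Nat.card G : ℕ) := by rw [← Nat.cast_mul, Nat.ordProj_mul_ordCompl_eq_self]
  have h2 : (f g : ℂ) ^ N - (if IsConj (pPrimePart {p} g) y then 1 else 0) =
      (ordProj[p] (Nat.card G) : ℕ) * k g := by exact_mod_cast congrArg (Int.cast (R := ℂ)) (hk g)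
  rw [← h1]
  split_ifs with h
  · rw [if_pos h] at h2
    linear_combination (ordCompl[p] (Nat.card G) : ℕ) * h2
  · rw [if_neg h] at h2
    linear_combination (ordCompl[p] (Nat.card G) : ℕ) * h2

open Classical in
/-- For `p ∈ P` the `P`-section of `x` is a union of `p`-sections. -/
theorem exists_charHat_eq_indicator_section {p : Nat.Primes} (hp : p ∈ P) (x : G) :
    ∃ v : RUPO G P, ∀ g, charHat P g v =
      if IsConj (pPrimePart P g) x then ((ordCompl[p] (Nat.card G) : ℕ) : ℂ) else 0 := by
  have := Fintype.ofFinite (ConjClasses G)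
  choose v hv using fun y : {y : G // IsPPrime {p} y} =>
    exists_charHat_eq_indicator_pSection P p y.2
  have hpart : ∀ g : G, pPrimePart P (pPrimePart {p} g) = pPrimePart P g :=
    pPrimePart_pPrimePart (Set.singleton_subset_iff.2 hp)
  let w : ConjClasses G → RUPO G P := fun c =>
    if h : IsPPrime {p} (Quotient.out c) ∧ IsConj (pPrimePart P (Quotient.out c)) x then
      v ⟨_, h.1⟩ else 0
  refine ⟨∑ c, w c, fun g => ?_⟩
  rw [map_sum]
  set c₀ := ConjClasses.mk (pPrimePart {p} g) with hc₀
  have hout : ∀ c : ConjClasses G,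
      IsConj (pPrimePart {p} g) (Quotient.out c) ↔ c = c₀ := fun c => by
    rw [← ConjClasses.mk_eq_mk_iff_isConj, eq_comm]
    exact Eq.congr_left (Quotient.out_eq c)
  have h0 := (hout c₀).2 rfl
  have hpp : IsPPrime {p} (Quotient.out c₀) := by
    obtain ⟨c, hc⟩ := isConj_iff.1 h0
    rw [← hc]
    exact (isPPrime_pPrimePart {p} g).of_dvd (orderOf_conj _ _).dvd
  have hx : IsConj (pPrimePart P (Quotient.out c₀)) x ↔ IsConj (pPrimePart P g) x := by
    have := isConj_pPrimePart P h0
    rw [hpart] at this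
    exact ⟨this.trans, this.symm.trans⟩
  rw [Finset.sum_eq_single c₀]
  · by_cases h : IsConj (pPrimePart P g) x
    · simp only [w]
      rw [dif_pos ⟨hpp, hx.2 h⟩, hv, if_pos h0, if_pos h]
    · simp only [w]
      rw [dif_neg fun h' => h (hx.1 h'.2), if_neg h, map_zero]
  · intro c _ hc
    simp only [w]
    split_ifs with h
    · rw [hv, if_neg (mt (hout c).1 hc)]
    · exact map_zero _
  · exact fun h => absurd (Finset.mem_univ _) h

open Classical in
/-- The indicator function of the `P`-section of `x` comes from `RUPO G P`: the integers `n` for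
which `n` times the function does so form an ideal which contains, for each `p ∈ P`, an integer
prime to `p`. -/
theorem exists_charHat_eq_indicator (x : G) :
    ∃ v : RUPO G P, ∀ g, charHat P g v = if IsConj (pPrimePart P g) x then 1 else 0 := by
  let I : Ideal ℤ :=
    { carrier := {n | ∃ v : RUPO G P, ∀ g, charHat P g v =
        if IsConj (pPrimePart P g) x then (n : ℂ) else 0}
      zero_mem' := ⟨0, fun g => by simp⟩
      add_mem' := by
        rintro m n ⟨v, hv⟩ ⟨w, hw⟩
        refine ⟨v + w, fun g => ?_⟩
        rw [map_add, hv, hw]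
        split_ifs <;> simp
      smul_mem' := by
        rintro m n ⟨v, hv⟩
        refine ⟨m * v, fun g => ?_⟩
        rw [map_mul, hv, map_intCast]
        split_ifs <;> simp }
  have hconj : ∀ g h, IsConj (pPrimePart P (h * g * h⁻¹)) x ↔ IsConj (pPrimePart P g) x :=
    fun g h => ⟨(isConj_pPrimePart P (isConj_iff.2 ⟨h, rfl⟩)).trans,
      (isConj_pPrimePart P (isConj_iff.2 ⟨h, rfl⟩)).symm.trans⟩
  have hI : (Nat.card G : ℤ) ∈ I := by
    obtain ⟨v, hv⟩ := exists_charHat_eq_card_mul P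
      (fun g => if IsConj (pPrimePart P g) x then 1 else 0) fun g h => by simp only [hconj]
    exact ⟨v, fun g => by rw [hv]; split_ifs <;> simp⟩
  have hIp : ∀ p ∈ P, ((ordCompl[(p : ℕ)] (Nat.card G) : ℕ) : ℤ) ∈ I := fun p hp => by
    obtain ⟨v, hv⟩ := exists_charHat_eq_indicator_section P hp x
    exact ⟨v, fun g => by rw [hv, Int.cast_natCast]⟩
  obtain ⟨d, hd⟩ := (IsPrincipalIdealRing.principal I).principal
  have hdI : ∀ n, n ∈ I ↔ d ∣ n := fun n => by
    rw [hd]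
    exact Ideal.mem_span_singleton
  have hdI' : ((d.natAbs : ℕ) : ℤ) ∈ I := (hdI _).2 (Int.dvd_natAbs_self)
  have hunit : IsUnit (d.natAbs : ZP P) := by
    refine isUnit_natCast_ZP ?_ fun p hp hpd => ?_
    · rintro h
      rw [Int.natAbs_eq_zero] at h
      have := (hdI _).1 hI
      rw [h, zero_dvd_iff] at this
      exact Nat.card_pos.ne' (Nat.cast_eq_zero.1 this)
    · refine Nat.not_dvd_ordCompl p.2 (Nat.card_pos (α := G)).ne' (hpd.trans ?_)
      exact Int.natAbs_dvd_natAbs.2 ((hdI _).1 (hIp p hp))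
  obtain ⟨v, hv⟩ := hdI'
  obtain ⟨z, hz⟩ := hunit.exists_left_inv
  refine ⟨fromZP P z * v, fun g => ?_⟩
  have h1 : charHat P g (fromZP P z) * (d.natAbs : ℂ) = 1 := by
    rw [← map_natCast (charHat P g), ← map_natCast (fromZP P), ← map_mul, ← map_mul, hz, map_one,
      map_one]
  rw [map_mul, hv]
  split_ifs
  · simpa using h1
  · rw [mul_zero]

end Idempotents

/-! ### Connected components and primitive idempotents -/

section Components

variable {G : Type u} [Group G] {P : Set Nat.Primes}

theorem isClopen_basicOpen {R : Type*} [CommRing R] {e : R} (he : IsIdempotentElem e) :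
    IsClopen (PrimeSpectrum.basicOpen e : Set (PrimeSpectrum R)) :=
  PrimeSpectrum.isClopen_iff.2 ⟨e, he, rfl⟩

theorem primeZero_mem_basicOpen {g : G} {e : RUPO G P} :
    primeZero P g ∈ PrimeSpectrum.basicOpen e ↔ charHat P g e ≠ 0 :=
  Iff.rfl

theorem charHat_eq_zero_or_one {e : RUPO G P} (he : IsIdempotentElem e) (g : G) :
    charHat P g e = 0 ∨ charHat P g e = 1 :=
  IsIdempotentElem.iff_eq_zero_or_one.1 (he.map (charHat P g))

theorem exists_rep (c : PPrimeClasses G P) :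
    ∃ (x : G) (hx : IsPPrime P x), PPrimeClasses.mk x hx = c := by
  obtain ⟨_, x, hx, rfl⟩ := c
  exact ⟨x, hx, rfl⟩

theorem PPrimeClasses.mk_eq_mk {x y : G} {hx : IsPPrime P x} {hy : IsPPrime P y} :
    PPrimeClasses.mk x hx = PPrimeClasses.mk y hy ↔ IsConj x y :=
  Subtype.ext_iff.trans ConjClasses.mk_eq_mk_iff_isConj

/-- A conjugacy-invariant map on `P`-prime elements which separates the classes and is surjective
induces a bijection on the set of classes. -/
theorem exists_equiv_pPrimeClasses {S : Type*} (f : G → S)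
    (hf : ∀ x y, IsPPrime P x → IsPPrime P y → (f x = f y ↔ IsConj x y))
    (hsurj : ∀ s, ∃ x, IsPPrime P x ∧ f x = s) :
    ∃ Φ : PPrimeClasses G P ≃ S,
      ∀ (x : G) (hx : IsPPrime P x), Φ (PPrimeClasses.mk x hx) = f x := by
  choose r hr hrc using exists_rep (G := G) (P := P)
  have hmk : ∀ (x : G) (hx : IsPPrime P x), f (r (PPrimeClasses.mk x hx)) = f x := fun x hx =>
    (hf _ _ (hr _) hx).2 (PPrimeClasses.mk_eq_mk.1 (hrc (PPrimeClasses.mk x hx)))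
  refine ⟨Equiv.ofBijective (fun c => f (r c)) ⟨fun c d hcd => ?_, fun s => ?_⟩, hmk⟩
  · rw [← hrc c, ← hrc d, PPrimeClasses.mk_eq_mk]
    exact (hf _ _ (hr c) (hr d)).1 hcd
  · obtain ⟨x, hx, rfl⟩ := hsurj s
    exact ⟨PPrimeClasses.mk x hx, hmk x hx⟩

variable [Finite G]

open Classical in
/-- The idempotent of `RUPO G P` whose character is the indicator function of the `P`-section
of `x`. -/
def sectionIdempotent (P : Set Nat.Primes) (x : G) : RUPO G P :=
  (exists_charHat_eq_indicator P x).choose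

open Classical in
theorem charHat_sectionIdempotent (x g : G) :
    charHat P g (sectionIdempotent P x) = if IsConj (pPrimePart P g) x then 1 else 0 :=
  (exists_charHat_eq_indicator P x).choose_spec g

theorem isIdempotentElem_sectionIdempotent (x : G) : IsIdempotentElem (sectionIdempotent P x) :=
  charHat_ext fun g => by
    rw [map_mul, charHat_sectionIdempotent]
    split_ifs <;> simp

theorem sectionIdempotent_eq_of_isConj {x y : G} (h : IsConj x y) :
    sectionIdempotent P x = sectionIdempotent P y := by
  classical
  refine charHat_ext fun g => ?_
  rw [charHat_sectionIdempotent, charHat_sectionIdempotent]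
  exact if_congr ⟨fun h' => h'.trans h, fun h' => h'.trans h.symm⟩ rfl rfl

theorem primeZero_mem_basicOpen_sectionIdempotent {x g : G} :
    primeZero P g ∈ PrimeSpectrum.basicOpen (sectionIdempotent P x) ↔
      IsConj (pPrimePart P g) x := by
  rw [primeZero_mem_basicOpen, charHat_sectionIdempotent]
  split_ifs with h
  · exact ⟨fun _ => h, fun _ => one_ne_zero⟩
  · exact ⟨fun h' => absurd rfl h', fun h' => absurd h' h⟩

theorem charHat_sectionIdempotent_self {x : G} (hx : IsPPrime P x) :
    charHat P x (sectionIdempotent P x) = 1 := by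
  rw [charHat_sectionIdempotent, hx.pPrimePart_eq, if_pos (IsConj.refl x)]

theorem connectedComponent_primeZero_eq_iff {x y : G} (hx : IsPPrime P x) (hy : IsPPrime P y) :
    connectedComponent (primeZero P x) = connectedComponent (primeZero P y) ↔ IsConj x y := by
  refine ⟨fun h => ?_, fun h => by rw [primeZero_eq_of_isConj h]⟩
  have hmem : primeZero P y ∈ PrimeSpectrum.basicOpen (sectionIdempotent P y) := by
    rw [primeZero_mem_basicOpen_sectionIdempotent, hy.pPrimePart_eq]
  have hsub := (isClopen_basicOpen
    (isIdempotentElem_sectionIdempotent y)).connectedComponent_subset hmem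
  have := hsub (h ▸ mem_connectedComponent)
  rwa [SetLike.mem_coe, primeZero_mem_basicOpen_sectionIdempotent, hx.pPrimePart_eq] at this

/-- A component meeting the open set of the idempotent of `x` lies in it and contains some
`primeZero P y` with `y` a `P`-prime element, which must then be conjugate to `x`. -/
theorem basicOpen_sectionIdempotent {x : G} (hx : IsPPrime P x) :
    (PrimeSpectrum.basicOpen (sectionIdempotent P x) : Set (PrimeSpectrum (RUPO G P))) =
      connectedComponent (primeZero P x) := by
  have hclopen := isClopen_basicOpen
    (isIdempotentElem_sectionIdempotent (P := P) x)
  refine Set.Subset.antisymm (fun q hq => ?_) (hclopen.connectedComponent_subset ?_)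
  · obtain ⟨y, hy, hqy⟩ := exists_connectedComponent_eq q
    have h1 : primeZero P y ∈ connectedComponent q := hqy ▸ mem_connectedComponent
    have h2 := hclopen.connectedComponent_subset hq h1
    rw [SetLike.mem_coe, primeZero_mem_basicOpen_sectionIdempotent, hy.pPrimePart_eq] at h2
    rw [primeZero_eq_of_isConj h2] at hqy
    exact hqy ▸ mem_connectedComponent
  · rw [SetLike.mem_coe, primeZero_mem_basicOpen_sectionIdempotent, hx.pPrimePart_eq]

/-- The open set of an idempotent is a union of connected components, so the character of an
idempotent is constant on `P`-sections. -/
theorem charHat_pPrimePart {e : RUPO G P} (he : IsIdempotentElem e) (g : G) :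
    charHat P (pPrimePart P g) e = charHat P g e := by
  have hclopen := isClopen_basicOpen he
  have hcomp := connectedComponent_primeZero_pPrimePart (P := P) g
  have h : charHat P (pPrimePart P g) e ≠ 0 ↔ charHat P g e ≠ 0 := by
    rw [← primeZero_mem_basicOpen, ← primeZero_mem_basicOpen]
    exact ⟨fun h => hclopen.connectedComponent_subset h (hcomp ▸ mem_connectedComponent),
      fun h => hclopen.connectedComponent_subset h (hcomp ▸ mem_connectedComponent)⟩
  rcases charHat_eq_zero_or_one he g with h1 | h1 <;>
    rcases charHat_eq_zero_or_one he (pPrimePart P g) with h2 | h2 <;> simp_all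

/-- Since the character of an idempotent is constant on `P`-sections, each idempotent either
contains or annihilates the idempotent of a given section. -/
theorem mul_sectionIdempotent {e : RUPO G P} (he : IsIdempotentElem e) {x : G}
    (hx : charHat P x e = 1) : e * sectionIdempotent P x = sectionIdempotent P x := by
  refine charHat_ext fun g => ?_
  rw [map_mul, charHat_sectionIdempotent]
  split_ifs with h
  · rw [← charHat_pPrimePart he, charHat_eq_of_isConj h, hx, mul_one]
  · rw [mul_zero]

theorem sectionIdempotent_ne_zero {x : G} (hx : IsPPrime P x) : sectionIdempotent P x ≠ 0 :=
  fun h => by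
    have := charHat_sectionIdempotent_self hx
    rw [h, map_zero] at this
    exact zero_ne_one this

theorem isPrimitiveIdempotent_sectionIdempotent {x : G} (hx : IsPPrime P x) :
    IsPrimitiveIdempotent (sectionIdempotent P x) := by
  refine ⟨isIdempotentElem_sectionIdempotent x, sectionIdempotent_ne_zero hx, ?_⟩
  have key : ∀ a b : RUPO G P, IsIdempotentElem a → IsIdempotentElem b →
      sectionIdempotent P x = a + b → charHat P x a = 1 → b = 0 := by
    intro a b ha hb hab hxa
    -- The values at each `g` are `0` or `1` and satisfy `a * e = a + b`, which excludes `b = 1`.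
    refine charHat_ext fun g => ?_
    rw [map_zero]
    have h1 := congrArg (charHat P g) hab
    rw [← mul_sectionIdempotent ha hxa, map_mul, map_add, charHat_sectionIdempotent] at h1
    rcases charHat_eq_zero_or_one ha g with h2 | h2 <;>
      rcases charHat_eq_zero_or_one hb g with h3 | h3 <;>
      · rw [h2, h3] at h1
        split_ifs at h1 <;> norm_num at h1 <;> simp [h3]
  intro a b ha hb hab
  rcases charHat_eq_zero_or_one ha x with h | h
  · refine Or.inl (key b a hb ha (hab.trans (add_comm a b)) ?_)
    have := charHat_sectionIdempotent_self hx
    rwa [hab, map_add, h, zero_add] at this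
  · exact Or.inr (key a b ha hb hab h)

theorem exists_eq_sectionIdempotent {e : RUPO G P} (he : IsPrimitiveIdempotent e) :
    ∃ x, IsPPrime P x ∧ e = sectionIdempotent P x := by
  obtain ⟨hid, h0, hprim⟩ := he
  obtain ⟨g, hg⟩ : ∃ g, charHat P g e ≠ 0 := by
    by_contra! h
    exact h0 (charHat_ext fun g => by rw [h, map_zero])
  refine ⟨pPrimePart P g, isPPrime_pPrimePart P g, ?_⟩
  have hx : charHat P (pPrimePart P g) e = 1 := by
    rw [charHat_pPrimePart hid]
    exact (charHat_eq_zero_or_one hid g).resolve_left hg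
  set s := sectionIdempotent P (pPrimePart P g)
  have hs : IsIdempotentElem s := isIdempotentElem_sectionIdempotent _
  have hes : e * s = s := mul_sectionIdempotent hid hx
  have hsub : IsIdempotentElem (e - s) := by
    have h1 : e * e = e := hid
    have h2 : s * s = s := hs
    change (e - s) * (e - s) = e - s
    linear_combination h1 + h2 - 2 * hes
  rcases hprim s (e - s) hs hsub (by ring) with h | h
  · exact absurd h (sectionIdempotent_ne_zero (isPPrime_pPrimePart P g))
  · exact sub_eq_zero.1 h

end Components

/-! ### The integral representation ring -/

section Integral

variable (G : Type u) [Group G]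

theorem algebraMap_int_ZP_univ_bijective :
    Function.Bijective (algebraMap ℤ (ZP Set.univ)) := by
  refine ⟨fun a b h => ?_, fun z => ?_⟩
  · have := congrArg (fun z : ZP Set.univ => (z : ℚ)) h
    simpa using this
  · obtain ⟨n, h0, hn, m, hm⟩ := exists_natCast_mul_eq_intCast z
    have : n = 1 := by
      by_contra h
      obtain ⟨p, hp, hd⟩ := Nat.exists_prime_and_dvd h
      exact hn ⟨p, hp⟩ (Set.mem_univ _) hd
    refine ⟨m, ?_⟩
    rw [this, Nat.cast_one, one_mul] at hm
    rw [hm, eq_intCast]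

/-- If all primes belong to `P`, then `ℤ[p⁻¹ | p ∉ P] = ℤ` and `RUP G P` is `RU G`. -/
def RUPUnivEquiv : RUP G Set.univ ≃ₐ[ℤ] RU G :=
  (Algebra.TensorProduct.congr (AlgEquiv.refl (R := ℤ) (A₁ := RU G))
    (AlgEquiv.ofBijective (Algebra.ofId ℤ (ZP Set.univ))
      algebraMap_int_ZP_univ_bijective).symm).trans
    (Algebra.TensorProduct.rid ℤ ℤ (RU G))

/-- If all primes belong to `P`, then `RUPO G P` is `RU(G) ⊗ 𝒪`. -/
def RUPOUnivEquiv : RUPO G Set.univ ≃+* RU G ⊗[ℤ] 𝓞 (SplitField G) :=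
  (Algebra.TensorProduct.congr (RUPUnivEquiv G)
    (AlgEquiv.refl (R := ℤ) (A₁ := 𝓞 (SplitField G)))).toRingEquiv

/-- The identity is the only element whose order is divisible by no prime, so there is a single
connected component. -/
theorem connectedSpace_primeSpectrum_RUPO_univ [Finite G] :
    ConnectedSpace (PrimeSpectrum (RUPO G Set.univ)) := by
  rw [connectedSpace_iff_connectedComponent]
  refine ⟨primeZero Set.univ 1, Set.eq_univ_of_forall fun q => ?_⟩
  obtain ⟨x, hx, hq⟩ := exists_connectedComponent_eq q
  have : x = 1 := hx.eq_one fun p _ => Set.mem_univ p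
  rw [← this, ← hq]
  exact mem_connectedComponent

theorem connectedSpace_primeSpectrum_RU [Finite G] :
    ConnectedSpace (PrimeSpectrum (RU G ⊗[ℤ] 𝓞 (SplitField G))) :=
  have := connectedSpace_primeSpectrum_RUPO_univ G
  (PrimeSpectrum.homeomorphOfRingEquiv (RUPOUnivEquiv G)).surjective.connectedSpace
    (PrimeSpectrum.homeomorphOfRingEquiv (RUPOUnivEquiv G)).continuous

end Integral

end

end RepRing

open Classical in
theorem mainTheorem2 {G : Type*} [Group G] [Finite G] (P : Set Nat.Primes) :
    (∃ Φ : RepRing.PPrimeClasses G P ≃ ConnectedComponents (PrimeSpectrum (RepRing.RUPO G P)),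
      ∀ (x : G) (hx : RepRing.IsPPrime P x),
        Φ (RepRing.PPrimeClasses.mk x hx) = ConnectedComponents.mk (RepRing.primeZero P x)) ∧
    (∃ e : RepRing.PPrimeClasses G P ≃
        {e : RepRing.RUPO G P // RepRing.IsPrimitiveIdempotent e},
      ∀ (x : G) (hx : RepRing.IsPPrime P x),
        ((PrimeSpectrum.basicOpen (e (RepRing.PPrimeClasses.mk x hx)).1 :
            Set (PrimeSpectrum (RepRing.RUPO G P))) =
          connectedComponent (RepRing.primeZero P x)) ∧
        ∀ g : G, RepRing.charHat P g (e (RepRing.PPrimeClasses.mk x hx)).1 =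
          if IsConj (RepRing.pPrimePart P g) x then 1 else 0) ∧
    ConnectedSpace (PrimeSpectrum (TensorProduct ℤ (RepRing.RU G)
      (NumberField.RingOfIntegers (RepRing.SplitField G)))) := by
  refine ⟨RepRing.exists_equiv_pPrimeClasses _ (fun x y hx hy => ?_) fun s => ?_, ?_,
    RepRing.connectedSpace_primeSpectrum_RU G⟩
  · exact ConnectedComponents.coe_eq_coe.trans (RepRing.connectedComponent_primeZero_eq_iff hx hy)
  · obtain ⟨q, rfl⟩ := ConnectedComponents.surjective_coe s
    obtain ⟨x, hx, hq⟩ := RepRing.exists_connectedComponent_eq q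
    exact ⟨x, hx, ConnectedComponents.coe_eq_coe.2 hq.symm⟩
  · -- Passing to `P`-prime parts makes the idempotent primitive for arbitrary elements of `G`.
    let f : G → {e : RepRing.RUPO G P // RepRing.IsPrimitiveIdempotent e} := fun x =>
      ⟨RepRing.sectionIdempotent P (RepRing.pPrimePart P x),
        RepRing.isPrimitiveIdempotent_sectionIdempotent (RepRing.isPPrime_pPrimePart P x)⟩
    have hf : ∀ x, RepRing.IsPPrime P x → (f x).1 = RepRing.sectionIdempotent P x := fun x hx =>
      congrArg (RepRing.sectionIdempotent P) hx.pPrimePart_eq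
    obtain ⟨e, he⟩ : ∃ e : RepRing.PPrimeClasses G P ≃
        {e : RepRing.RUPO G P // RepRing.IsPrimitiveIdempotent e},
        ∀ (x : G) (hx : RepRing.IsPPrime P x), e (RepRing.PPrimeClasses.mk x hx) = f x := by
      refine RepRing.exists_equiv_pPrimeClasses f (fun x y hx hy => ?_) fun s => ?_
      · rw [Subtype.ext_iff, hf x hx, hf y hy]
        refine ⟨fun h => ?_, RepRing.sectionIdempotent_eq_of_isConj⟩
        rw [← RepRing.connectedComponent_primeZero_eq_iff hx hy,
          ← RepRing.basicOpen_sectionIdempotent hx, h, RepRing.basicOpen_sectionIdempotent hy]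
      · obtain ⟨x, hx, hs⟩ := RepRing.exists_eq_sectionIdempotent s.2
        exact ⟨x, hx, Subtype.ext ((hf x hx).trans hs.symm)⟩
    refine ⟨e, fun x hx => ?_⟩
    rw [he x hx, hf x hx]
    exact ⟨RepRing.basicOpen_sectionIdempotent hx, RepRing.charHat_sectionIdempotent x⟩
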